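/- Let $\Bbbk$ be a field, let $A_r$ be the quiver $1\to 2\to\cdots\to r$ (straight orientation), and consider finite-dimensional representations of $A_r$ over $\Bbbk$. A representation $V$ is exceptional if $\mathrm{End}(V)$ is a division ring and $\mathrm{Ext}^i(V,V)=0$ for all $i\ge 1$. A (complete) exceptional sequence on $A_r$ is a sequence $(E_1,\dots,E_r)$ of exceptional representations with $\mathrm{Hom}(E_i,E_j)=0=\mathrm{Ext}^1(E_i,E_j)$ for all $j<i$. A (complete) exceptional set is a set of $r$ isomorphism classes of representations that can be ordered into such a sequence. In an exceptional sequence, $E_i$ is relatively injective if it is an injective object of the full subcategory of all $W$ with $\mathrm{Hom}(W,V)=0=\mathrm{Ext}^1(W,V)$, where $V=E_1\oplus\cdots\oplus E_{i-1}$; it is relatively projective if it is a projective object of the full subcategory of all $W$ with $\mathrm{Hom}(V',W)=0=\mathrm{Ext}^1(V',W)$, where $V'=E_{i+1}\oplus\cdots\oplus E_r$. An element of an exceptional set is relatively injective (projective) if it is so in some exceptional sequence ordering the set (this does not depend on the ordering). For $n,m\ge 0$ let $N_{n,m}$ be the number of exceptional sets on $A_{n+m}$ having exactly $n$ relatively injective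 elements. For each $r$ there are finitely many exceptional sets on $A_r$, and $N_{0,0}=1$, $N_{0,k}=0$ for $k>0$, and for all $n\ge 1$, $m\ge 0$, $$N_{n,m}=\sum_{\substack{a+b+c=n-1\\ i+j+k=m\\ a,b,c,i,j,k\ge 0}} N_{a,i}\,N_{j,b}\,N_{c,k}.$$ Moreover, for any array of non-negative integers $(N_{n,m})_{n,m\ge0}$, these conditions (the initial values together with the recursion) hold if and only if the formal power series $f(x,y)=\sum_{n,m\ge 0}N_{n,m}x^ny^m$ satisfies $$f(x,y)=1+x\,f(x,y)^2\,f(y,x);$$ in particular this equation holds for the numbers $N_{n,m}$ above. For $m=0$, $N_{n,0}=\frac{1}{n+1}\binom{2n}{n}=C_n$, the $n$-th Catalan number. The same recursion, and hence the same functional equation and the same values for $m=0$, hold if "relatively injective" is replaced with "relatively projective" throughout. -/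

import Mathlib

open CategoryTheory CategoryTheory.Limits

universe w v u

section Abelian

attribute [local instance] Abelian.hasFiniteBiproducts

variable {C : Type u} [Category.{v} C] [Abelian C] [HasExt.{w} C]

/-- An object is exceptional if its endomorphism ring is a division ring and all its higher
self-extension groups vanish. -/
structure IsExceptional (V : C) : Prop where
  nontrivial : Nontrivial (End V)
  isUnit : ∀ f : End V, f ≠ 0 → IsUnit f
  ext : ∀ i : ℕ, 1 ≤ i → Subsingleton (Abelian.Ext.{w} V V i)

/-- `Hom(V, W) = 0 = Ext¹(V, W)`. -/
structure HomExtVanish (V W : C) : Prop where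
  hom : ∀ f : V ⟶ W, f = 0
  ext : Subsingleton (Abelian.Ext.{w} V W 1)

/-- The objects `W` of the right perpendicular category of `V`: `Hom(V, W) = 0 = Ext¹(V, W)`. -/
def rightPerp (V : C) : ObjectProperty C := fun W => HomExtVanish.{w} V W

/-- The objects `W` of the left perpendicular category of `V`: `Hom(W, V) = 0 = Ext¹(W, V)`. -/
def leftPerp (V : C) : ObjectProperty C := fun W => HomExtVanish.{w} W V

/-- `M` is relatively projective with respect to `V`: it is a projective object of the full
subcategory of objects right perpendicular to `V`. -/
def IsRelProjectiveWrt (V M : C) : Prop :=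
  ∃ h : rightPerp.{w} V M, Projective (⟨M, h⟩ : (rightPerp.{w} V).FullSubcategory)

/-- `M` is relatively injective with respect to `V`: it is an injective object of the full
subcategory of objects left perpendicular to `V`. -/
def IsRelInjectiveWrt (V M : C) : Prop :=
  ∃ h : leftPerp.{w} V M, Injective (⟨M, h⟩ : (leftPerp.{w} V).FullSubcategory)

/-- `(E₁, …, Eᵣ)` is an exceptional sequence: every term is exceptional, and
`Hom(Eᵢ, Eⱼ) = 0 = Ext¹(Eᵢ, Eⱼ)` for `j < i`. -/
structure IsExceptionalSequence {r : ℕ} (E : Fin r → C) : Prop where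
  exceptional : ∀ i, IsExceptional.{w} (E i)
  vanish : ∀ i j, j < i → HomExtVanish.{w} (E i) (E j)

/-- The term `Eᵢ` of a sequence `E` is relatively projective with respect to the direct sum of
the terms that come after it. -/
def IsRelProjectiveInSeq {r : ℕ} (E : Fin r → C) (i : Fin r) : Prop :=
  IsRelProjectiveWrt.{w} (⨁ fun j : Set.Ioi i => E j) (E i)

/-- The term `Eᵢ` of a sequence `E` is relatively injective with respect to the direct sum of
the terms that come before it. -/
def IsRelInjectiveInSeq {r : ℕ} (E : Fin r → C) (i : Fin r) : Prop :=
  IsRelInjectiveWrt.{w} (⨁ fun j : Set.Iio i => E j) (E i)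

end Abelian

/-- The vertices of the straight quiver `1 → 2 → ⋯ → n`. -/
def LinearQuiver (n : ℕ) : Type := Fin n

/-- There is exactly one arrow from each vertex to the next one, and no other arrow. -/
instance (n : ℕ) : Quiver.{0} (LinearQuiver n) where
  Hom i j := PLift (@Fin.val n i + 1 = @Fin.val n j)

/-- Finite-dimensional representations over `k` of the straight quiver with `n` vertices:
functors from the free category on the quiver to finite-dimensional vector spaces. -/
abbrev LinearRep (k : Type u) [Field k] (n : ℕ) : Type (u + 1) :=
  Paths (LinearQuiver n) ⥤ FGModuleCat.{u} k

instance (k : Type u) [Field k] (n : ℕ) : HasExt.{u + 1} (LinearRep k n) :=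
  HasExt.standard _

/-- Isomorphism classes of representations of the straight quiver with `n` vertices. -/
abbrev LinearRepClass (k : Type u) [Field k] (n : ℕ) : Type (u + 1) :=
  Quotient (isIsomorphicSetoid (LinearRep k n))

/-- The isomorphism class of a representation. -/
def linearRepClass {k : Type u} [Field k] {n : ℕ} (V : LinearRep k n) : LinearRepClass k n :=
  Quotient.mk (isIsomorphicSetoid (LinearRep k n)) V

/-- `E` is a complete exceptional sequence (as many terms as vertices) whose terms, up to
isomorphism, are the elements of `S`. -/
def IsOrdering {k : Type u} [Field k] {n : ℕ} (S : Set (LinearRepClass k n))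
    (E : Fin n → LinearRep k n) : Prop :=
  IsExceptionalSequence.{u + 1} E ∧ Set.range (fun i => linearRepClass (E i)) = S

/-- A (complete) exceptional set: a set of isomorphism classes that can be ordered into a
complete exceptional sequence. -/
def IsExceptionalSet {k : Type u} [Field k] {n : ℕ} (S : Set (LinearRepClass k n)) : Prop :=
  ∃ E : Fin n → LinearRep k n, IsOrdering S E

/-- The relatively injective objects of `S`: those that are relatively injective in an exceptional
sequence that orders `S`. -/
def relInjectives {k : Type u} [Field k] {n : ℕ} (S : Set (LinearRepClass k n)) :
    Set (LinearRepClass k n) :=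
  {x | ∃ E : Fin n → LinearRep k n, IsOrdering S E ∧
    ∃ i, linearRepClass (E i) = x ∧ IsRelInjectiveInSeq.{u + 1} E i}

/-- The relatively projective objects of `S`: those that are relatively projective in an
exceptional sequence that orders `S`. -/
def relProjectives {k : Type u} [Field k] {n : ℕ} (S : Set (LinearRepClass k n)) :
    Set (LinearRepClass k n) :=
  {x | ∃ E : Fin n → LinearRep k n, IsOrdering S E ∧
    ∃ i, linearRepClass (E i) = x ∧ IsRelProjectiveInSeq.{u + 1} E i}

/-- The number of exceptional sets on the straight quiver with `n + m` vertices that have exactly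
`n` relatively injective objects. -/
noncomputable def numRelInjective (k : Type u) [Field k] (n m : ℕ) : ℕ :=
  Set.ncard {S : Set (LinearRepClass k (n + m)) |
    IsExceptionalSet S ∧ (relInjectives S).ncard = n}

/-- The number of exceptional sets on the straight quiver with `n + m` vertices that have exactly
`n` relatively projective objects. -/
noncomputable def numRelProjective (k : Type u) [Field k] (n m : ℕ) : ℕ :=
  Set.ncard {S : Set (LinearRepClass k (n + m)) |
    IsExceptionalSet S ∧ (relProjectives S).ncard = n}

/-- The recursion: `N₀₀ = 1`, `N₀ₖ = 0` for `k > 0`, and for `n ≥ 1`, `Nₙₘ` is the sum of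
`N_{a,i} N_{j,b} N_{c,k}` over `a + b + c = n - 1` and `i + j + k = m`. -/
def SatisfiesRecursion (N : ℕ → ℕ → ℕ) : Prop :=
  N 0 0 = 1 ∧ (∀ k, 0 < k → N 0 k = 0) ∧
    ∀ n m, 1 ≤ n → N n m =
      ∑ p ∈ Finset.Nat.antidiagonalTuple 3 (n - 1), ∑ q ∈ Finset.Nat.antidiagonalTuple 3 m,
        N (p 0) (q 0) * N (q 1) (p 1) * N (p 2) (q 2)

/-- The formal power series `f(x, y) = ∑ Nₙₘ xⁿ yᵐ`; the variables `0` and `1` are `x` and `y`. -/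
def twoVarGenFun (N : ℕ → ℕ → ℕ) : MvPowerSeries (Fin 2) ℤ :=
  fun d => (N (d 0) (d 1) : ℤ)

/-- The functional equation `f(x, y) = 1 + x f(x, y)² f(y, x)`. -/
def SatisfiesFunctionalEquation (N : ℕ → ℕ → ℕ) : Prop :=
  twoVarGenFun N = 1 + MvPowerSeries.X 0 * twoVarGenFun N ^ 2 *
    MvPowerSeries.rename (Equiv.swap (0 : Fin 2) 1) (twoVarGenFun N)

-- An exceptional representation is an interval module, with support `[a, b)`
-- (`exists_iso_interval`, `isExceptional_interval`). Read it as an arc from `a` to `b` on the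
-- points `0, …, n`. The projective resolution of `[a, b)` by `[b, n)` and `[a, n)` computes Hom and
-- Ext¹ into `[c, d)`: both vanish exactly if `[c, d)` contains both or neither of `a` and `b`
-- (`vanish_interval_iff`). Complete exceptional sets thus become noncrossing spanning trees on `n +
-- 1` points.
--
-- The category is hereditary, so a perpendicular object is relatively projective once it has no
-- extension by a perpendicular interval module, and this is also necessary
-- (`isRelProjectiveWrt_iff`). The resulting condition on an arc `e` does not depend on the ordering
-- (`nonProj_iff_of_orderedBy`). In the tree it says: `e` is relatively projective if and only if
-- its right end remains connected to the last point `n` after `e` is deleted.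
--
-- Let `(p, t)` be the longest arc that ends in the last point `t`. The other arcs form trees `A` on
-- `0, …, p`, `B` on `p, …, q` and `C` on `q + 1, …, t`, where `p`, `q` and the pieces are
-- determined by the tree and the pieces are arbitrary (`Complete.exists_split`, `Complete.join`,
-- `joinArcs_injective`). The arc `(p, t)` is relatively projective. `A` and `C` are attached to it
-- at their last points, so their arcs keep their status. `B` is attached at its first point; after
-- a reflection of `B`, relatively projective and other arcs are exchanged
-- (`Complete.nonProj_iff_not_cononProj`, `nonProj_flip`). This exchange is the factor `N_{j,b}`, or
-- `f(y, x)`. The count is carried out on ternary trees (`TernaryTree.sum_nonProj`,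
-- `TernaryTree.satisfiesRecursion_count`).
--
-- Duality acts on arcs as reflection and interchanges injective and projective, so both counts
-- agree. The functional equation is the recursion read off coefficientwise.

/-! ### Representations of the straight quiver in concrete terms -/

namespace LinearRep

-- Vertices, and uniqueness of paths between them

section Vertices

variable {n : ℕ}

/-- The position of a vertex. -/
def idx (i : Paths (LinearQuiver n)) : ℕ := @Fin.val n i

/-- The vertex in a given position. -/
def vtx (a : ℕ) (h : a < n) : Paths (LinearQuiver n) := (⟨a, h⟩ : Fin n)

@[simp] lemma idx_vtx (a : ℕ) (h : a < n) : idx (vtx a h) = a := rfl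

lemma idx_lt (i : Paths (LinearQuiver n)) : idx i < n := @Fin.isLt n i

lemma idx_injective : Function.Injective (idx (n := n)) := fun _ _ h => Fin.ext h

lemma idx_le_of_hom {i j : Paths (LinearQuiver n)} (p : i ⟶ j) : idx i ≤ idx j := by
  refine Paths.induction_fixed_source (fun {j} _ => idx i ≤ idx j) le_rfl
    (fun {j l} _ e ih => le_trans ih ?_) p
  have : idx (n := n) j + 1 = idx (n := n) l := e.down
  exact this ▸ Nat.le_succ _

lemma nonempty_hom (i j : Paths (LinearQuiver n)) (h : idx i ≤ idx j) : Nonempty (i ⟶ j) := by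
  obtain ⟨d, hd⟩ := Nat.exists_eq_add_of_le h
  induction d generalizing j with
  | zero => obtain rfl : i = j := idx_injective (by omega)
            exact ⟨𝟙 _⟩
  | succ d ih =>
    have hlt : idx i + d < n := by have := idx_lt j; omega
    obtain ⟨p⟩ := ih (vtx (idx i + d) hlt) (by simp) rfl
    exact ⟨p.cons ⟨by change idx i + d + 1 = idx j; omega⟩⟩

/-- Every arrow raises the position by one, so the ends of a path force its length and its
intermediate vertices. -/
lemma path_eq {i j : LinearQuiver n} (p q : Quiver.Path i j) : p = q := by
  induction p with
  | nil =>
    cases q with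
    | nil => rfl
    | cons q e =>
      have h := idx_le_of_hom q
      have := e.down
      unfold idx at h; omega
  | cons p e ih =>
    cases q with
    | nil =>
      have h := idx_le_of_hom p
      have := e.down
      unfold idx at h; omega
    | cons q e' =>
      rename_i b c b'
      obtain rfl : b = b' := Fin.ext (by have := e.down; have := e'.down; omega)
      have he : e = e' := by
        rcases e with ⟨_⟩
        rcases e' with ⟨_⟩
        rfl
      rw [ih q, he]

instance (i j : Paths (LinearQuiver n)) : Subsingleton (i ⟶ j) := ⟨path_eq⟩

/-- The path between two vertices. -/
noncomputable def pathOf {i j : Paths (LinearQuiver n)} (h : idx i ≤ idx j) : i ⟶ j :=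
  (nonempty_hom i j h).some

end Vertices

variable {k : Type u} [Field k] {n : ℕ}

/-- The linear map attached to a path. -/
def tr (W : LinearRep k n) {i j : Paths (LinearQuiver n)} (p : i ⟶ j) :
    W.obj i →ₗ[k] W.obj j := (W.map p).hom.hom

/-- The components of a morphism. -/
def cmp {V W : LinearRep k n} (f : V ⟶ W) (i : Paths (LinearQuiver n)) :
    V.obj i →ₗ[k] W.obj i := (f.app i).hom.hom

lemma tr_self (W : LinearRep k n) {i : Paths (LinearQuiver n)} (p : i ⟶ i) (x : W.obj i) :
    W.tr p x = x := by
  rw [Subsingleton.elim p (𝟙 i), tr, W.map_id]; rfl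

lemma tr_tr (W : LinearRep k n) {i j l : Paths (LinearQuiver n)} (p : i ⟶ j) (q : j ⟶ l)
    (r : i ⟶ l) (x : W.obj i) : W.tr q (W.tr p x) = W.tr r x := by
  rw [Subsingleton.elim r (p ≫ q), tr, tr, tr, W.map_comp]; rfl

lemma cmp_tr {V W : LinearRep k n} (f : V ⟶ W) {i j : Paths (LinearQuiver n)} (p : i ⟶ j)
    (x : V.obj i) : cmp f j (V.tr p x) = W.tr p (cmp f i x) :=
  LinearMap.congr_fun (congrArg (fun g => g.hom.hom) (f.naturality p)) x

lemma hom_ext' {V W : LinearRep k n} {f g : V ⟶ W} (h : ∀ i x, cmp f i x = cmp g i x) :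
    f = g := by
  ext i x; exact h i x

/-- A morphism of representations from its components. -/
def homMk {V W : LinearRep k n} (f : ∀ i, V.obj i →ₗ[k] W.obj i)
    (h : ∀ i j (p : i ⟶ j) x, f j (V.tr p x) = W.tr p (f i x)) : V ⟶ W where
  app i := FGModuleCat.ofHom (f i)
  naturality i j p := by ext x; exact h i j p x

@[simp] lemma cmp_homMk {V W : LinearRep k n} (f : ∀ i, V.obj i →ₗ[k] W.obj i)
    (h : ∀ i j (p : i ⟶ j) x, f j (V.tr p x) = W.tr p (f i x)) (i) (x : V.obj i) :
    cmp (homMk f h) i x = f i x := rfl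

@[simp] lemma cmp_comp {V W U : LinearRep k n} (f : V ⟶ W) (g : W ⟶ U) (i) (x : V.obj i) :
    cmp (f ≫ g) i x = cmp g i (cmp f i x) := rfl

@[simp] lemma cmp_zero (V W : LinearRep k n) (i) (x : V.obj i) : cmp (0 : V ⟶ W) i x = 0 := rfl

lemma isZero_of_forall {V : LinearRep k n} (h : ∀ i (x : V.obj i), x = 0) : IsZero V := by
  rw [IsZero.iff_id_eq_zero]
  exact hom_ext' fun i x => h i _

lemma mono_of_injective {V W : LinearRep k n} (f : V ⟶ W)
    (h : ∀ i, Function.Injective (cmp f i)) : Mono f :=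
  ⟨fun g g' e => hom_ext' fun i x => h i (by rw [← cmp_comp, ← cmp_comp, e])⟩

lemma epi_of_surjective {V W : LinearRep k n} (f : V ⟶ W)
    (h : ∀ i, Function.Surjective (cmp f i)) : Epi f :=
  ⟨fun g g' e => hom_ext' fun i x => by
    obtain ⟨y, rfl⟩ := h i x
    rw [← cmp_comp, ← cmp_comp, e]⟩

lemma surjective_of_epi {V W : LinearRep k n} (f : V ⟶ W) [Epi f] (i) :
    Function.Surjective (cmp f i) := by
  have : Epi ((forget₂ (FGModuleCat k) (ModuleCat k)).map (f.app i)) := inferInstance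
  exact (ModuleCat.epi_iff_surjective _).1 this

lemma injective_of_mono {V W : LinearRep k n} (f : V ⟶ W) [Mono f] (i) :
    Function.Injective (cmp f i) := by
  have : Mono ((forget₂ (FGModuleCat k) (ModuleCat k)).map (f.app i)) := inferInstance
  exact (ModuleCat.mono_iff_injective _).1 this

/-! ### Interval modules -/

variable (k) in
/-- The line `k` if `P` holds, and `0` otherwise. -/
def lineSub (P : Prop) : Submodule k k where
  carrier := {x | ¬ P → x = 0}
  add_mem' hx hy h := by rw [hx h, hy h, add_zero]
  zero_mem' _ := rfl
  smul_mem' c x hx h := by rw [hx h, smul_zero]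

open Classical in
/-- The map between the lines of two conditions that is the identity where both hold. -/
noncomputable def cut (P Q : Prop) : lineSub k P →ₗ[k] lineSub k Q where
  toFun x := ⟨if Q then x.1 else 0, fun h => if_neg h⟩
  map_add' x y := by ext; by_cases h : Q <;> simp [h]
  map_smul' c x := by ext; by_cases h : Q <;> simp [h]

open Classical in
lemma cut_val (P Q : Prop) (x : lineSub k P) : (cut P Q x).1 = if Q then x.1 else 0 := rfl

variable (k n) in
/-- The interval module with support `[a, b)`. -/
noncomputable def interval (a b : ℕ) : LinearRep k n :=
  Paths.lift
    { obj := fun i => FGModuleCat.of k (lineSub k (a ≤ @Fin.val n i ∧ @Fin.val n i < b))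
      map := fun _ => FGModuleCat.ofHom (cut _ _) }

/-- The coordinate of an element of an interval module. -/
noncomputable def coord (a b : ℕ) (i : Paths (LinearQuiver n)) :
    (interval k n a b).obj i →ₗ[k] k :=
  (lineSub k (a ≤ idx i ∧ idx i < b)).subtype

lemma coord_injective (a b : ℕ) (i : Paths (LinearQuiver n)) :
    Function.Injective (coord (k := k) a b i) := Subtype.val_injective

lemma coord_eq_zero (a b : ℕ) (i : Paths (LinearQuiver n)) (x : (interval k n a b).obj i)
    (h : ¬ (a ≤ idx i ∧ idx i < b)) : coord a b i x = 0 := x.2 h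

lemma eq_zero_of_not (a b : ℕ) (i : Paths (LinearQuiver n)) (x : (interval k n a b).obj i)
    (h : ¬ (a ≤ idx i ∧ idx i < b)) : x = 0 :=
  coord_injective a b i (by rw [coord_eq_zero a b i x h, map_zero])

/-- The element of an interval module with given coordinate. -/
noncomputable def elt (a b : ℕ) (i : Paths (LinearQuiver n)) (h : a ≤ idx i ∧ idx i < b) (x : k) :
    (interval k n a b).obj i :=
  show lineSub k (a ≤ idx i ∧ idx i < b) from ⟨x, fun h' => absurd h h'⟩

@[simp] lemma coord_elt (a b : ℕ) (i : Paths (LinearQuiver n)) (h : a ≤ idx i ∧ idx i < b) (x : k) :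
    coord a b i (elt a b i h x) = x := rfl

/-- The support is convex: a path with both ends in it never leaves it, so the composite of the cuts
along the arrows is again a cut. -/
lemma coord_tr (a b : ℕ) {i j : Paths (LinearQuiver n)} (p : i ⟶ j)
    (x : (interval k n a b).obj i) :
    coord a b j ((interval k n a b).tr p x) = if a ≤ idx j ∧ idx j < b then coord a b i x else 0 := by
  classical
  refine Paths.induction_fixed_source (fun {j} p => coord a b j ((interval k n a b).tr p x) =
    if a ≤ idx j ∧ idx j < b then coord a b i x else 0) ?_ (fun {j l} p e ih => ?_) p
  · rw [tr_self]
    split_ifs with h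
    · rfl
    · exact coord_eq_zero a b i x h
  · have he : idx (n := n) j + 1 = idx (n := n) l := e.down
    have hp : idx i ≤ idx (n := n) j := idx_le_of_hom p
    have h2 : ∀ y : (interval k n a b).obj j,
        coord a b l ((interval k n a b).tr (Quiver.Hom.toPath e) y) =
          if a ≤ idx (n := n) l ∧ idx (n := n) l < b then coord a b j y else 0 := by
      intro y
      refine (cut_val (a ≤ idx (n := n) j ∧ idx (n := n) j < b)
        (a ≤ idx (n := n) l ∧ idx (n := n) l < b) y).trans ?_
      congr
    refine (congrArg (coord a b l) (tr_tr _ p (Quiver.Hom.toPath e) _ x).symm).trans ?_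
    refine (h2 _).trans ?_
    refine (congrArg (fun y => if a ≤ idx (n := n) l ∧ idx (n := n) l < b then y else 0) ih).trans ?_
    change (if a ≤ idx (n := n) l ∧ idx (n := n) l < b then
      if a ≤ idx (n := n) j ∧ idx (n := n) j < b then coord a b i x else 0 else 0) =
      if a ≤ idx (n := n) l ∧ idx (n := n) l < b then coord a b i x else 0
    split_ifs with h3 h4
    · rfl
    -- Here `l` lies in the support and its predecessor `j` does not, so `j` and hence `i` lie below
    -- `a`.
    · exact (coord_eq_zero a b i x fun h => h4 (by omega)).symm
    · rfl

/-- The components of the canonical map between interval modules. -/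
noncomputable def cutMap (a b c d : ℕ) (i : Paths (LinearQuiver n)) :
    (interval k n a b).obj i →ₗ[k] (interval k n c d).obj i :=
  cut (a ≤ idx i ∧ idx i < b) (c ≤ idx i ∧ idx i < d)

lemma coord_cutMap (a b c d : ℕ) (i : Paths (LinearQuiver n)) (x : (interval k n a b).obj i) :
    coord c d i (cutMap a b c d i x) =
      if c ≤ idx i ∧ idx i < d then coord a b i x else 0 := by
  classical
  refine (cut_val _ _ _).trans ?_; congr

/-- The canonical map between interval modules: the identity on the common support. -/
noncomputable def canHom (a b c d : ℕ) (hca : c ≤ a) (hdb : d ≤ b) :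
    interval k n a b ⟶ interval k n c d :=
  homMk (cutMap a b c d) (by
    intro i j p x
    apply coord_injective
    have hp := idx_le_of_hom p
    rw [coord_tr, coord_cutMap, coord_cutMap, coord_tr]
    by_cases h : a ≤ idx i ∧ idx i < b
    · split_ifs <;> first | rfl | omega
    · rw [coord_eq_zero a b i x h]; simp)

lemma coord_canHom (a b c d : ℕ) (hca : c ≤ a) (hdb : d ≤ b) (i : Paths (LinearQuiver n))
    (x : (interval k n a b).obj i) : coord c d i (cmp (canHom a b c d hca hdb) i x) =
      if c ≤ idx i ∧ idx i < d then coord a b i x else 0 :=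
  coord_cutMap a b c d i x

/-- The generator of an interval module. -/
noncomputable def gen (a b : ℕ) (ha : a < n) (hab : a < b) : (interval k n a b).obj (vtx a ha) :=
  elt a b (vtx a ha) ⟨le_rfl, hab⟩ 1

/-- An interval module is generated by its vector at the lowest vertex of the support. -/
lemma interval_hom_ext {a b : ℕ} (ha : a < n) (hab : a < b) {W : LinearRep k n}
    {f g : interval k n a b ⟶ W}
    (h : cmp f (vtx a ha) (gen a b ha hab) = cmp g (vtx a ha) (gen a b ha hab)) : f = g := by
  refine hom_ext' fun i x => ?_
  by_cases hi : a ≤ idx i ∧ idx i < b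
  · have hx : x = coord a b i x • (interval k n a b).tr (pathOf (i := vtx a ha) hi.1)
        (gen a b ha hab) := by
      apply coord_injective
      rw [map_smul, coord_tr, if_pos hi, gen, coord_elt, smul_eq_mul, mul_one]
    rw [hx, map_smul, map_smul, cmp_tr, cmp_tr, h]
  · rw [eq_zero_of_not a b i x hi, map_zero, map_zero]

/-- The morphism from an interval module given by the image of the generator. -/
noncomputable def ofElt {a b : ℕ} (ha : a < n) {W : LinearRep k n} (w : W.obj (vtx a ha))
    (hw : ∀ j (p : vtx a ha ⟶ j), b ≤ idx j → W.tr p w = 0) : interval k n a b ⟶ W :=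
  homMk (fun i => (LinearMap.toSpanSingleton k (W.obj i)
      (if h : a ≤ idx i then W.tr (pathOf (i := vtx a ha) h) w else 0)) ∘ₗ coord a b i) (by
    intro i j p x
    have hp := idx_le_of_hom p
    by_cases hi : a ≤ idx i ∧ idx i < b
    · have haj : a ≤ idx j := hi.1.trans hp
      simp only [LinearMap.comp_apply, LinearMap.toSpanSingleton_apply, coord_tr, map_smul,
        dif_pos hi.1, dif_pos haj]
      rw [tr_tr _ _ p (pathOf (i := vtx a ha) haj)]
      by_cases hj : idx j < b
      · rw [if_pos ⟨haj, hj⟩]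
      · rw [hw _ _ (not_lt.1 hj), smul_zero, smul_zero]
    · rw [eq_zero_of_not a b i x hi]; simp)

lemma cmp_ofElt_gen {a b : ℕ} (ha : a < n) (hab : a < b) {W : LinearRep k n}
    (w : W.obj (vtx a ha)) (hw : ∀ j (p : vtx a ha ⟶ j), b ≤ idx j → W.tr p w = 0) :
    cmp (ofElt ha w hw) (vtx a ha) (gen a b ha hab) = w := by
  simp only [ofElt, cmp_homMk, LinearMap.comp_apply, LinearMap.toSpanSingleton_apply, gen,
    coord_elt, one_smul, idx_vtx, le_refl, dif_pos, tr_self]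

/-- A morphism to an interval module given by a functional on the last space of the support. -/
noncomputable def toIntervalHom {a c : ℕ} (hc : c < n) {V : LinearRep k n}
    (hV : ∀ i, idx i < a → ∀ x : V.obj i, x = 0) (φ : V.obj (vtx c hc) →ₗ[k] k) :
    V ⟶ interval k n a (c + 1) :=
  homMk (fun i => LinearMap.codRestrict (lineSub k (a ≤ idx i ∧ idx i < c + 1))
      (if h : idx i ≤ c then φ ∘ₗ V.tr (pathOf (j := vtx c hc) h) else 0) (by
        intro x hi
        split_ifs with h
        · rw [hV i (by omega) x, map_zero]
        · rfl)) (by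
    intro i j p x
    have hp := idx_le_of_hom p
    apply coord_injective
    rw [coord_tr]
    change (if h : idx j ≤ c then φ ∘ₗ V.tr (pathOf (j := vtx c hc) h) else 0) (V.tr p x) =
      if _ then (if h : idx i ≤ c then φ ∘ₗ V.tr (pathOf (j := vtx c hc) h) else 0) x else 0
    by_cases hj : idx j ≤ c
    · have hi : idx i ≤ c := hp.trans hj
      rw [dif_pos hj, dif_pos hi, LinearMap.comp_apply, LinearMap.comp_apply,
        tr_tr _ p _ (pathOf (j := vtx c hc) hi)]
      split_ifs with h
      · rfl
      · rw [hV i (by omega) x, map_zero, map_zero]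
    · rw [dif_neg hj, if_neg (by omega)]; rfl)

lemma coord_toIntervalHom {a c : ℕ} (hc : c < n) {V : LinearRep k n}
    (hV : ∀ i, idx i < a → ∀ x : V.obj i, x = 0) (φ : V.obj (vtx c hc) →ₗ[k] k)
    (i : Paths (LinearQuiver n)) (hi : idx i ≤ c) (p : i ⟶ vtx c hc) (x : V.obj i) :
    coord a (c + 1) i (cmp (toIntervalHom hc hV φ) i x) = φ (V.tr p x) := by
  rw [Subsingleton.elim p (pathOf (j := vtx c hc) hi)]
  change (if h : idx i ≤ c then φ ∘ₗ V.tr (pathOf (j := vtx c hc) h) else 0) x = _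
  rw [dif_pos hi]; rfl

end LinearRep

/-! ### Perpendicular categories in hereditary abelian categories -/

namespace HomExt

open Abelian

attribute [local instance] Abelian.hasFiniteBiproducts

variable {C : Type u} [Category.{v} C] [Abelian C] [HasExt.{w} C]

lemma subsingleton_of_forall {X Y : C} {n : ℕ} (h : ∀ x : Ext.{w} X Y n, x = 0) :
    Subsingleton (Ext.{w} X Y n) := ⟨fun x y => by rw [h x, h y]⟩

lemma subsingleton_zero_iff {X Y : C} :
    Subsingleton (Ext.{w} X Y 0) ↔ ∀ f : X ⟶ Y, f = 0 := by
  rw [Ext.homEquiv₀.subsingleton_congr]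
  exact ⟨fun _ f => Subsingleton.elim _ _, fun h => ⟨fun f g => by rw [h f, h g]⟩⟩

lemma vanish_iff {X Y : C} : HomExtVanish.{w} X Y ↔
    Subsingleton (Ext.{w} X Y 0) ∧ Subsingleton (Ext.{w} X Y 1) := by
  rw [subsingleton_zero_iff]
  exact ⟨fun h => ⟨h.hom, h.ext⟩, fun h => ⟨h.1, h.2⟩⟩

lemma subsingleton_of_retract_left {X X' Y : C} (r : Retract X' X) {n : ℕ}
    (h : Subsingleton (Ext.{w} X Y n)) : Subsingleton (Ext.{w} X' Y n) :=
  subsingleton_of_forall fun x => by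
    have e : (Ext.mk₀ r.i).comp ((Ext.mk₀ r.r).comp x (zero_add n)) (zero_add n) = x := by
      rw [Ext.mk₀_comp_mk₀_assoc, r.retract, Ext.mk₀_id_comp]
    rw [← e, Subsingleton.elim ((Ext.mk₀ r.r).comp x (zero_add n)) 0, Ext.comp_zero]

lemma subsingleton_of_retract_right {X Y Y' : C} (r : Retract Y' Y) {n : ℕ}
    (h : Subsingleton (Ext.{w} X Y n)) : Subsingleton (Ext.{w} X Y' n) :=
  subsingleton_of_forall fun x => by
    have e : (x.comp (Ext.mk₀ r.i) (add_zero n)).comp (Ext.mk₀ r.r) (add_zero n) = x := by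
      rw [Ext.comp_assoc_of_third_deg_zero, Ext.mk₀_comp_mk₀, r.retract, Ext.comp_mk₀_id]
    rw [← e, Subsingleton.elim (x.comp (Ext.mk₀ r.i) (add_zero n)) 0, Ext.zero_comp]

lemma vanish_of_retract_left {X X' Y : C} (r : Retract X' X) (h : HomExtVanish.{w} X Y) :
    HomExtVanish.{w} X' Y := by
  rw [vanish_iff] at *
  exact ⟨subsingleton_of_retract_left r h.1, subsingleton_of_retract_left r h.2⟩

lemma vanish_of_retract_right {X Y Y' : C} (r : Retract Y' Y) (h : HomExtVanish.{w} X Y) :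
    HomExtVanish.{w} X Y' := by
  rw [vanish_iff] at *
  exact ⟨subsingleton_of_retract_right r h.1, subsingleton_of_retract_right r h.2⟩

/-- An isomorphism presents its source as a retract of its target. -/
def retractOfIso {X Y : C} (e : X ≅ Y) : Retract X Y := ⟨e.hom, e.inv, e.hom_inv_id⟩

lemma subsingleton_congr {X X' Y Y' : C} (e : X ≅ X') (e' : Y ≅ Y') {n : ℕ} :
    Subsingleton (Ext.{w} X Y n) ↔ Subsingleton (Ext.{w} X' Y' n) :=
  ⟨fun h => subsingleton_of_retract_left (retractOfIso e.symm)
      (subsingleton_of_retract_right (retractOfIso e'.symm) h),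
    fun h => subsingleton_of_retract_left (retractOfIso e)
      (subsingleton_of_retract_right (retractOfIso e') h)⟩

lemma vanish_congr {X X' Y Y' : C} (e : X ≅ X') (e' : Y ≅ Y') :
    HomExtVanish.{w} X Y ↔ HomExtVanish.{w} X' Y' := by
  rw [vanish_iff, vanish_iff, subsingleton_congr e e', subsingleton_congr e e']

lemma vanish_biproduct_left {J : Type} [Finite J] (E : J → C) (W : C) :
    HomExtVanish.{w} (⨁ E) W ↔ ∀ j, HomExtVanish.{w} (E j) W := by
  refine ⟨fun h j => vanish_of_retract_left ⟨biproduct.ι E j, biproduct.π E j, by simp⟩ h,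
    fun h => vanish_iff.2 ?_⟩
  have := Fintype.ofFinite J
  have h0 : ∀ j, Subsingleton (Ext.{w} (E j) W 0) := fun j => (vanish_iff.1 (h j)).1
  have h1 : ∀ j, Subsingleton (Ext.{w} (E j) W 1) := fun j => (vanish_iff.1 (h j)).2
  exact ⟨(Ext.biproductAddEquiv (biproduct.isBilimit E) W 0).toEquiv.subsingleton_congr.2
      inferInstance,
    (Ext.biproductAddEquiv (biproduct.isBilimit E) W 1).toEquiv.subsingleton_congr.2
      inferInstance⟩

lemma vanish_biproduct_right {J : Type} [Finite J] (E : J → C) (W : C) :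
    HomExtVanish.{w} W (⨁ E) ↔ ∀ j, HomExtVanish.{w} W (E j) := by
  refine ⟨fun h j => vanish_of_retract_right ⟨biproduct.ι E j, biproduct.π E j, by simp⟩ h,
    fun h => vanish_iff.2 ?_⟩
  have := Fintype.ofFinite J
  have h0 : ∀ j, Subsingleton (Ext.{w} W (E j) 0) := fun j => (vanish_iff.1 (h j)).1
  have h1 : ∀ j, Subsingleton (Ext.{w} W (E j) 1) := fun j => (vanish_iff.1 (h j)).2
  exact ⟨(Ext.addEquivBiproduct W (biproduct.isBilimit E) 0).toEquiv.subsingleton_congr.2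
      inferInstance,
    (Ext.addEquivBiproduct W (biproduct.isBilimit E) 1).toEquiv.subsingleton_congr.2
      inferInstance⟩

-- Vanishing of Ext along short exact sequences

section LongExactSequences

variable {S : ShortComplex C} (hS : S.ShortExact)
include hS

lemma covariant₂ {X : C} {n : ℕ} (h₁ : Subsingleton (Ext.{w} X S.X₁ n))
    (h₃ : Subsingleton (Ext.{w} X S.X₃ n)) : Subsingleton (Ext.{w} X S.X₂ n) :=
  subsingleton_of_forall fun x => by
    obtain ⟨y, rfl⟩ := Ext.covariant_sequence_exact₂ X hS x (Subsingleton.elim _ _)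
    rw [Subsingleton.elim y 0, Ext.zero_comp]

lemma covariant₃ {X : C} {n : ℕ} (h₂ : Subsingleton (Ext.{w} X S.X₂ n))
    (h₁ : Subsingleton (Ext.{w} X S.X₁ (n + 1))) : Subsingleton (Ext.{w} X S.X₃ n) :=
  subsingleton_of_forall fun x => by
    obtain ⟨y, rfl⟩ := Ext.covariant_sequence_exact₃ X hS x rfl (Subsingleton.elim _ _)
    rw [Subsingleton.elim y 0, Ext.zero_comp]

lemma covariant₁ {X : C} {n : ℕ} (h₃ : Subsingleton (Ext.{w} X S.X₃ n))
    (h₂ : Subsingleton (Ext.{w} X S.X₂ (n + 1))) : Subsingleton (Ext.{w} X S.X₁ (n + 1)) :=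
  subsingleton_of_forall fun x => by
    obtain ⟨y, rfl⟩ := Ext.covariant_sequence_exact₁ X hS x (Subsingleton.elim _ _) rfl
    rw [Subsingleton.elim y 0, Ext.zero_comp]

lemma contravariant₂ {Y : C} {n : ℕ} (h₁ : Subsingleton (Ext.{w} S.X₁ Y n))
    (h₃ : Subsingleton (Ext.{w} S.X₃ Y n)) : Subsingleton (Ext.{w} S.X₂ Y n) :=
  subsingleton_of_forall fun x => by
    obtain ⟨y, rfl⟩ := Ext.contravariant_sequence_exact₂ hS Y x (Subsingleton.elim _ _)
    rw [Subsingleton.elim y 0, Ext.comp_zero]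

lemma contravariant₁ {Y : C} {n : ℕ} (h₂ : Subsingleton (Ext.{w} S.X₂ Y n))
    (h₃ : Subsingleton (Ext.{w} S.X₃ Y (n + 1))) : Subsingleton (Ext.{w} S.X₁ Y n) :=
  subsingleton_of_forall fun x => by
    obtain ⟨y, rfl⟩ := Ext.contravariant_sequence_exact₁ hS Y x (add_comm 1 n)
      (Subsingleton.elim _ _)
    rw [Subsingleton.elim y 0, Ext.comp_zero]

lemma contravariant₃ {Y : C} {n : ℕ} (h₁ : Subsingleton (Ext.{w} S.X₁ Y n))
    (h₂ : Subsingleton (Ext.{w} S.X₂ Y (n + 1))) : Subsingleton (Ext.{w} S.X₃ Y (n + 1)) :=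
  subsingleton_of_forall fun x => by
    obtain ⟨y, rfl⟩ := Ext.contravariant_sequence_exact₃ hS Y x (Subsingleton.elim _ _)
      (add_comm 1 n)
    rw [Subsingleton.elim y 0, Ext.comp_zero]

lemma covariant_mono {X : C} (h₂ : Subsingleton (Ext.{w} X S.X₂ 0)) :
    Subsingleton (Ext.{w} X S.X₁ 0) := by
  have := hS.mono_f
  rw [subsingleton_zero_iff] at *
  exact fun f => by rw [← cancel_mono S.f, h₂ (f ≫ S.f), zero_comp]

lemma contravariant_epi {Y : C} (h₂ : Subsingleton (Ext.{w} S.X₂ Y 0)) :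
    Subsingleton (Ext.{w} S.X₃ Y 0) := by
  have := hS.epi_g
  rw [subsingleton_zero_iff] at *
  exact fun f => by rw [← cancel_epi S.g, h₂ (S.g ≫ f), comp_zero]

/-- `Ext¹` out of the projective middle term vanishes, so `Ext¹` out of the quotient is the cokernel
of restriction from `Hom(S.X₂, Y)` to `Hom(S.X₁, Y)`. -/
lemma subsingleton_one_iff [Projective S.X₂] {Y : C} :
    Subsingleton (Ext.{w} S.X₃ Y 1) ↔ ∀ φ : S.X₁ ⟶ Y, ∃ ψ : S.X₂ ⟶ Y, S.f ≫ ψ = φ := by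
  constructor
  · intro h φ
    obtain ⟨x, hx⟩ := Ext.contravariant_sequence_exact₁ hS Y (Ext.mk₀ φ) (add_zero 1)
      (Subsingleton.elim _ _)
    obtain ⟨ψ, rfl⟩ := (Ext.mk₀_bijective _ _).2 x
    exact ⟨ψ, (Ext.mk₀_bijective _ _).1 (by rw [← hx, Ext.mk₀_comp_mk₀])⟩
  · intro h
    refine subsingleton_of_forall fun x => ?_
    have := Ext.subsingleton_of_projective.{w} S.X₂ Y 0
    obtain ⟨y, rfl⟩ := Ext.contravariant_sequence_exact₃ hS Y x (Subsingleton.elim _ _)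
      (add_zero 1)
    obtain ⟨φ, rfl⟩ := (Ext.mk₀_bijective _ _).2 y
    obtain ⟨ψ, rfl⟩ := h φ
    rw [← Ext.mk₀_comp_mk₀, ← Ext.comp_assoc_of_third_deg_zero, hS.extClass_comp, Ext.zero_comp]

lemma subsingleton_of_two_le [Projective S.X₁] [Projective S.X₂] {Y : C} {n : ℕ} :
    Subsingleton (Ext.{w} S.X₃ Y (n + 2)) :=
  contravariant₃ hS (Ext.subsingleton_of_projective.{w} S.X₁ Y n)
    (Ext.subsingleton_of_projective.{w} S.X₂ Y (n + 1))

end LongExactSequences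

-- Perpendicular categories when `Ext²` vanishes

section Hereditary

variable (hC : ∀ X Y : C, Subsingleton (Ext.{w} X Y 2))
include hC

/-- `Ext¹(V, -)` is right exact because `Ext²` vanishes. So it is zero on the image of `f`, a
quotient of `X`, and on the cokernel, a quotient of `Y`. The former, with `Hom(V, Y) = 0`, makes
`Hom(V, -)` of the cokernel zero. -/
lemma rightPerp_cokernel {V X Y : C} (f : X ⟶ Y) (hX : HomExtVanish.{w} V X)
    (hY : HomExtVanish.{w} V Y) : HomExtVanish.{w} V (cokernel (Abelian.image.ι f)) := by
  rw [vanish_iff] at *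
  have h₁ : (ShortComplex.mk _ _ (kernel.condition (Abelian.factorThruImage f))).ShortExact :=
    { exact := ShortComplex.exact_kernel _ }
  have h₂ : (ShortComplex.mk _ _ (cokernel.condition (Abelian.image.ι f))).ShortExact :=
    { exact := ShortComplex.exact_cokernel _ }
  have hI := covariant₃ h₁ hX.2 (hC _ _)
  exact ⟨covariant₃ h₂ hY.1 hI, covariant₃ h₂ hY.2 (hC _ _)⟩

lemma leftPerp_kernel {V X Y : C} (f : X ⟶ Y) (hX : HomExtVanish.{w} X V)
    (hY : HomExtVanish.{w} Y V) : HomExtVanish.{w} (kernel (Abelian.factorThruImage f)) V := by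
  rw [vanish_iff] at *
  have h₁ : (ShortComplex.mk _ _ (kernel.condition (Abelian.factorThruImage f))).ShortExact :=
    { exact := ShortComplex.exact_kernel _ }
  have h₂ : (ShortComplex.mk _ _ (cokernel.condition (Abelian.image.ι f))).ShortExact :=
    { exact := ShortComplex.exact_cokernel _ }
  have hI := contravariant₁ h₂ hY.2 (hC _ _)
  exact ⟨contravariant₁ h₁ hX.1 hI, contravariant₁ h₁ hX.2 (hC _ _)⟩

/-- An epimorphism of the perpendicular category is one of the ambient category, since its ambient
cokernel is again perpendicular and therefore zero. Its kernel is perpendicular too, so the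
obstruction to lifting lies in an `Ext¹` that vanishes. -/
lemma projective_of_ext {V M : C} (hM : rightPerp.{w} V M)
    (h : ∀ W, rightPerp.{w} V W → Subsingleton (Ext.{w} M W 1)) :
    Projective (⟨M, hM⟩ : (rightPerp.{w} V).FullSubcategory) := by
  refine ⟨fun {X Y} g f hf => ?_⟩
  let Q : (rightPerp.{w} V).FullSubcategory :=
    ⟨_, rightPerp_cokernel hC f.hom X.property Y.property⟩
  let p : Y ⟶ Q := ⟨cokernel.π (Abelian.image.ι f.hom)⟩
  have hp : p = 0 := by
    rw [← cancel_epi f]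
    ext
    change f.hom ≫ cokernel.π (Abelian.image.ι f.hom) = f.hom ≫ 0
    rw [comp_zero]
    refine (congrArg (· ≫ cokernel.π (Abelian.image.ι f.hom))
      (Abelian.image.fac f.hom).symm).trans ?_
    rw [Category.assoc, cokernel.condition, comp_zero]
  have hp' : cokernel.π (Abelian.image.ι f.hom) = 0 := congrArg (fun q => q.hom) hp
  have : Epi (Abelian.image.ι f.hom) := Preadditive.epi_of_cokernel_zero hp'
  have : Epi f.hom := by
    rw [← Abelian.image.fac f.hom]; infer_instance
  have hS : (ShortComplex.mk _ _ (kernel.condition f.hom)).ShortExact :=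
    { exact := ShortComplex.exact_kernel _ }
  have hX := vanish_iff.1 X.property
  have hY := vanish_iff.1 Y.property
  have hK : HomExtVanish.{w} V (kernel f.hom) :=
    vanish_iff.2 ⟨covariant_mono hS hX.1, covariant₁ hS hY.1 hX.2⟩
  have := h _ hK
  obtain ⟨x, hx⟩ := Ext.covariant_sequence_exact₃ M hS (Ext.mk₀ g.hom) (zero_add 1)
    (Subsingleton.elim _ _)
  obtain ⟨ψ, rfl⟩ := (Ext.mk₀_bijective _ _).2 x
  exact ⟨⟨ψ⟩, by
    ext
    exact (Ext.mk₀_bijective _ _).1 (by rw [← hx, Ext.mk₀_comp_mk₀]; rfl)⟩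

lemma injective_of_ext {V M : C} (hM : leftPerp.{w} V M)
    (h : ∀ W, leftPerp.{w} V W → Subsingleton (Ext.{w} W M 1)) :
    Injective (⟨M, hM⟩ : (leftPerp.{w} V).FullSubcategory) := by
  refine ⟨fun {X Y} g f hf => ?_⟩
  let K : (leftPerp.{w} V).FullSubcategory :=
    ⟨_, leftPerp_kernel hC f.hom X.property Y.property⟩
  let p : K ⟶ X := ⟨kernel.ι (Abelian.factorThruImage f.hom)⟩
  have hp : p = 0 := by
    rw [← cancel_mono f]
    ext
    change kernel.ι (Abelian.factorThruImage f.hom) ≫ f.hom = 0 ≫ f.hom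
    rw [zero_comp]
    refine (congrArg (kernel.ι (Abelian.factorThruImage f.hom) ≫ ·)
      (Abelian.image.fac f.hom).symm).trans ?_
    rw [← Category.assoc, kernel.condition, zero_comp]
  have hp' : kernel.ι (Abelian.factorThruImage f.hom) = 0 := congrArg (fun q => q.hom) hp
  have : Mono (Abelian.factorThruImage f.hom) := Preadditive.mono_of_kernel_zero hp'
  have : Mono f.hom := by
    rw [← Abelian.image.fac f.hom]; infer_instance
  have hS : (ShortComplex.mk _ _ (cokernel.condition f.hom)).ShortExact :=
    { exact := ShortComplex.exact_cokernel _ }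
  have hX := vanish_iff.1 X.property
  have hY := vanish_iff.1 Y.property
  have hQ : HomExtVanish.{w} (cokernel f.hom) V :=
    vanish_iff.2 ⟨contravariant_epi hS hY.1, contravariant₃ hS hX.1 hY.2⟩
  have := h _ hQ
  obtain ⟨x, hx⟩ := Ext.contravariant_sequence_exact₁ hS M (Ext.mk₀ g.hom) (add_zero 1)
    (Subsingleton.elim _ _)
  obtain ⟨ψ, rfl⟩ := (Ext.mk₀_bijective _ _).2 x
  exact ⟨⟨ψ⟩, by
    ext
    exact (Ext.mk₀_bijective _ _).1 (by rw [← hx, Ext.mk₀_comp_mk₀]; rfl)⟩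

end Hereditary

end HomExt

/-! ### Morphisms and extensions between interval modules -/

namespace LinearRep

open Abelian HomExt

variable {k : Type u} [Field k] {n : ℕ}

lemma isZero_interval {a b : ℕ} (h : n ≤ a ∨ b ≤ a) : IsZero (interval k n a b) :=
  isZero_of_forall fun i x => eq_zero_of_not a b i x (by have := idx_lt i; omega)

/-- For `a < n`, no vertex lies beyond the support, so morphisms from `[a, n)` to `W` are the
vectors of `W` at `a`, and vectors lift along surjections. -/
instance projective_interval (a : ℕ) : Projective (interval k n a n) := by
  by_cases ha : a < n
  · refine ⟨fun {E X} f e he => ?_⟩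
    obtain ⟨w, hw⟩ := surjective_of_epi e (vtx a ha) (cmp f _ (gen a n ha ha))
    refine ⟨ofElt ha w fun j p h => absurd h (by have := idx_lt j; omega),
      interval_hom_ext ha ha ?_⟩
    rw [cmp_comp, cmp_ofElt_gen ha ha, hw]
  · exact (isZero_interval (Or.inl (not_lt.1 ha))).projective

lemma canHom_comp_canHom_eq_zero {a b : ℕ} (hab : a ≤ b) (hbn : b ≤ n) :
    canHom (k := k) (n := n) b n a n hab le_rfl ≫ canHom a n a b le_rfl hbn = 0 := by
  refine hom_ext' fun i x => coord_injective _ _ _ ?_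
  rw [cmp_comp, coord_canHom, coord_canHom, cmp_zero, map_zero]
  by_cases h : b ≤ idx i ∧ idx i < n
  · rw [if_neg (by omega)]
  · rw [coord_eq_zero b n i x h]; simp

/-- A morphism killed by the projection to `[a, b)` has zero coordinates below `b`, so cutting it
off there loses nothing. -/
lemma exists_lift_of_comp_eq_zero {a b : ℕ} (hab : a ≤ b) (hbn : b ≤ n) {A : LinearRep k n}
    (g : A ⟶ interval k n a n) (hg : g ≫ canHom a n a b le_rfl hbn = 0) :
    ∃ l : A ⟶ interval k n b n, l ≫ canHom b n a n hab le_rfl = g := by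
  have h : ∀ i x, ¬ b ≤ idx i → coord a n i (cmp g i x) = 0 := fun i x hi => by
    have h := congrArg (fun f => coord a b i (cmp f i x)) hg
    simp only [cmp_comp, coord_canHom, cmp_zero, map_zero] at h
    by_cases h2 : a ≤ idx i
    · rwa [if_pos (by omega)] at h
    · exact coord_eq_zero a n i _ (by omega)
  refine ⟨homMk (fun i => cutMap a n b n i ∘ₗ cmp g i) fun i j p x => coord_injective _ _ _ ?_,
    hom_ext' fun i x => coord_injective _ _ _ ?_⟩
  · have hp := idx_le_of_hom p
    have := idx_lt j
    simp only [LinearMap.comp_apply, coord_cutMap, coord_tr, cmp_tr]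
    by_cases h1 : b ≤ idx i
    · split_ifs <;> first | rfl | omega
    · rw [h i x h1]; simp
  · have := idx_lt i
    simp only [cmp_comp, coord_canHom, cmp_homMk, LinearMap.comp_apply, coord_cutMap]
    by_cases h1 : b ≤ idx i
    · rw [if_pos (by omega), if_pos (by omega)]
    · rw [h i x h1]; simp

variable (k) in
/-- The projective resolution of an interval module. -/
noncomputable def resolution {a b : ℕ} (hab : a ≤ b) (hbn : b ≤ n) : ShortComplex (LinearRep k n) :=
  ShortComplex.mk _ _ (canHom_comp_canHom_eq_zero hab hbn)

lemma resolution_shortExact {a b : ℕ} (hab : a ≤ b) (hbn : b ≤ n) :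
    (resolution k hab hbn).ShortExact := by
  have hmono : Mono (canHom (k := k) (n := n) b n a n hab le_rfl) :=
    mono_of_injective _ fun i x y hxy => by
      apply coord_injective
      have h := congrArg (coord a n i) hxy
      rw [coord_canHom, coord_canHom] at h
      by_cases hi : a ≤ idx i ∧ idx i < n
      · rwa [if_pos hi, if_pos hi] at h
      · rw [coord_eq_zero b n i x (by omega), coord_eq_zero b n i y (by omega)]
  have hepi : Epi (canHom (k := k) (n := n) a n a b le_rfl hbn) :=
    epi_of_surjective _ fun i y => by
      by_cases hi : a ≤ idx i ∧ idx i < b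
      · refine ⟨elt a n i ⟨hi.1, by omega⟩ (coord a b i y), coord_injective _ _ _ ?_⟩
        rw [coord_canHom, if_pos hi, coord_elt]
      · exact ⟨0, by rw [map_zero, eq_zero_of_not a b i y hi]⟩
  have : Mono (resolution k hab hbn).f := hmono
  refine { exact := ?_, mono_f := hmono, epi_g := hepi }
  apply ShortComplex.exact_of_f_is_kernel
  exact KernelFork.IsLimit.ofι' _ _ fun {A} g hg =>
    ⟨(exists_lift_of_comp_eq_zero hab hbn g hg).choose,
      (exists_lift_of_comp_eq_zero hab hbn g hg).choose_spec⟩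

instance {a b : ℕ} (hab : a ≤ b) (hbn : b ≤ n) : Projective (resolution k hab hbn).X₁ :=
  projective_interval b

instance {a b : ℕ} (hab : a ≤ b) (hbn : b ≤ n) : Projective (resolution k hab hbn).X₂ :=
  projective_interval a

lemma subsingleton_ext_interval {a b : ℕ} (hab : a ≤ b) (hbn : b ≤ n) (W : LinearRep k n) (i : ℕ) :
    Subsingleton (Ext.{u + 1} (interval k n a b) W (i + 2)) :=
  subsingleton_of_two_le.{u + 1} (resolution_shortExact (k := k) hab hbn) (Y := W) (n := i)

/-- A nonzero image of the generator needs `a` in `[c, d)`. If moreover `b < d`, the generator dies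
at `b` while a nonzero image would survive there. -/
lemma interval_hom_eq_zero {a b c d : ℕ} (hab : a < b) (ha : a < n) (hd : d ≤ n)
    (h : ¬ (c ≤ a ∧ a < d ∧ d ≤ b)) (f : interval k n a b ⟶ interval k n c d) : f = 0 := by
  refine interval_hom_ext ha hab (coord_injective _ _ _ ?_)
  rw [cmp_zero, map_zero]
  by_cases h1 : c ≤ a ∧ a < d
  · have hb : b < n := by omega
    have e : (interval k n a b).tr (pathOf (i := vtx a ha) (j := vtx b hb) hab.le)
        (gen a b ha hab) = 0 := eq_zero_of_not _ _ _ _ (by simp)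
    have e2 := congrArg (fun y => coord c d _ (cmp f _ y)) e
    simp only [cmp_tr, map_zero] at e2
    rwa [coord_tr, if_pos (by rw [idx_vtx]; omega)] at e2
  · exact coord_eq_zero _ _ _ _ (by rw [idx_vtx]; exact h1)

lemma canHom_ne_zero {a b c d : ℕ} (ha : a < n) (hca : c ≤ a) (hdb : d ≤ b) (had : a < d) :
    canHom (k := k) (n := n) a b c d hca hdb ≠ 0 := by
  intro h
  have h2 := congrArg (fun f => coord c d _ (cmp f _ (gen a b ha (had.trans_le hdb)))) h
  simp only [coord_canHom, cmp_zero, map_zero, gen, coord_elt] at h2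
  rw [if_pos (by rw [idx_vtx]; exact ⟨hca, had⟩)] at h2
  exact one_ne_zero h2

lemma forall_hom_eq_zero_iff {a b c d : ℕ} (hab : a < b) (hbn : b ≤ n) (hdn : d ≤ n) :
    (∀ f : interval k n a b ⟶ interval k n c d, f = 0) ↔ ¬ (c ≤ a ∧ a < d ∧ d ≤ b) :=
  ⟨fun h h' => canHom_ne_zero (by omega) h'.1 h'.2.2 h'.2.1 (h _),
    interval_hom_eq_zero hab (by omega) hdn⟩

/-- By the resolution, `Ext¹` is the cokernel of the transition map of `[c, d)` from its space at
`a` to its space at `b`. It is nonzero exactly if `b` lies in `[c, d)` and `a` does not. -/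
lemma subsingleton_ext_one_iff {a b c d : ℕ} (hab : a < b) (hbn : b ≤ n) (hdn : d ≤ n) :
    Subsingleton (Ext.{u + 1} (interval k n a b) (interval k n c d) 1) ↔
      ¬ (a < c ∧ c ≤ b ∧ b < d) := by
  have key : Subsingleton (Ext.{u + 1} (interval k n a b) (interval k n c d) 1) ↔
      ∀ φ : interval k n b n ⟶ interval k n c d, ∃ ψ : interval k n a n ⟶ interval k n c d,
        canHom b n a n hab.le le_rfl ≫ ψ = φ :=
    subsingleton_one_iff.{u + 1} (resolution_shortExact (k := k) hab.le hbn)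
      (Y := interval k n c d)
  refine key.trans ⟨fun h h' => ?_, fun h φ => ?_⟩
  · obtain ⟨ψ, hψ⟩ := h (canHom b n c d h'.2.1 hdn)
    refine canHom_ne_zero (k := k) (n := n) (by omega) h'.2.1 hdn h'.2.2 (hψ.symm.trans ?_)
    rw [interval_hom_eq_zero (by omega) (by omega) hdn (by omega) ψ]
    exact comp_zero
  · by_cases h1 : c ≤ b ∧ b < d
    · have hbn' : b < n := by omega
      have han : a < n := by omega
      let w : (interval k n c d).obj (vtx a han) :=
        elt c d (vtx a han) (by rw [idx_vtx]; omega) (coord c d _ (cmp φ _ (gen b n hbn' hbn')))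
      refine ⟨ofElt (b := n) han w (fun j p hj => absurd hj (by have := idx_lt j; omega)), ?_⟩
      refine interval_hom_ext hbn' hbn' (coord_injective _ _ _ ?_)
      have e : cmp (canHom (k := k) (n := n) b n a n hab.le le_rfl) (vtx b hbn') (gen b n hbn' hbn') =
          (interval k n a n).tr (pathOf (i := vtx a han) (j := vtx b hbn') hab.le)
            (gen a n han han) := by
        apply coord_injective
        rw [coord_canHom, coord_tr, gen, gen, coord_elt, coord_elt]
      rw [cmp_comp, e, cmp_tr, cmp_ofElt_gen, coord_tr, if_pos (by rw [idx_vtx]; exact h1)]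
      exact coord_elt _ _ _ _ _
    · refine ⟨0, ?_⟩
      rw [comp_zero]
      by_cases hb : b < n
      · exact (interval_hom_eq_zero hb hb hdn (by omega) φ).symm
      · exact ((isZero_interval (Or.inl (not_lt.1 hb))).eq_of_src _ _)

/-- Nonzero Hom means that `a` lies in `[c, d)` and `b` does not, nonzero `Ext¹` the reverse; a
single equivalence excludes both. -/
lemma vanish_interval_iff {a b c d : ℕ} (hab : a < b) (hbn : b ≤ n) (hdn : d ≤ n) :
    HomExtVanish.{u + 1} (interval k n a b) (interval k n c d) ↔
      ((c ≤ a ∧ a < d) ↔ (c ≤ b ∧ b < d)) := by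
  have h0 := forall_hom_eq_zero_iff (k := k) (c := c) (d := d) hab hbn hdn
  have h1 := subsingleton_ext_one_iff (k := k) (c := c) (d := d) hab hbn hdn
  constructor
  · intro h
    have := h0.1 h.hom
    have := h1.1 h.ext
    omega
  · exact fun h => ⟨h0.2 (by omega), h1.2 (by omega)⟩

/-- The space at `a` is a line, so an endomorphism is the scalar by which it multiplies the
generator. -/
lemma isExceptional_interval {a b : ℕ} (hab : a < b) (hbn : b ≤ n) :
    IsExceptional.{u + 1} (interval k n a b) := by
  have ha : a < n := by omega
  have hsmul : ∀ f : interval k n a b ⟶ interval k n a b, ∃ c : k, f = c • 𝟙 _ := fun f =>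
    ⟨coord a b _ (cmp f _ (gen a b ha hab)), interval_hom_ext ha hab (coord_injective _ _ _ (by
      change _ = coord (k := k) (n := n) a b _
        (coord (k := k) (n := n) a b _ (cmp f _ (gen a b ha hab)) • gen (k := k) a b ha hab)
      rw [map_smul, gen, coord_elt, smul_eq_mul, mul_one]))⟩
  have hne : (𝟙 (interval k n a b)) ≠ 0 := fun h =>
    canHom_ne_zero (k := k) (n := n) ha (le_refl a) (le_refl b) hab
      (by rw [← Category.comp_id (canHom (k := k) (n := n) a b a b _ _), h, comp_zero])
  refine ⟨⟨⟨𝟙 _, 0, hne⟩⟩, fun f hf => ?_, fun i hi => ?_⟩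
  · obtain ⟨c, rfl⟩ := hsmul f
    have hc : c ≠ 0 := fun h => hf (by rw [h, zero_smul])
    have h1 : ∀ c d : k, c * d = 1 →
        (c • 𝟙 (interval k n a b)) ≫ (d • 𝟙 (interval k n a b)) = 𝟙 _ := fun c d h => by
      rw [Linear.smul_comp, Linear.comp_smul, smul_smul, h, one_smul, Category.comp_id]
    exact ⟨⟨_, c⁻¹ • 𝟙 (interval k n a b), h1 _ _ (inv_mul_cancel₀ hc),
      h1 _ _ (mul_inv_cancel₀ hc)⟩, rfl⟩
  · obtain rfl | h := hi.eq_or_lt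
    · exact (subsingleton_ext_one_iff hab hbn hbn).2 (by omega)
    · obtain ⟨j, rfl⟩ := Nat.exists_eq_add_of_le' h
      exact subsingleton_ext_interval hab.le hbn _ j

end LinearRep

/-! ### Classification of exceptional representations and relative projectivity -/

/-- An arc on the points `0, …, n`. -/
def IsArc (n : ℕ) (x : ℕ × ℕ) : Prop := x.1 < x.2 ∧ x.2 ≤ n

/-- The endpoints of `x` are both inside or both outside of the support `[y.1, y.2)` of `y`. -/
def ArcVanish (x y : ℕ × ℕ) : Prop := (y.1 ≤ x.1 ∧ x.1 < y.2) ↔ (y.1 ≤ x.2 ∧ x.2 < y.2)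

/-- The numerical condition for a nonsplit extension of the interval module of `x` by that
of `y`. -/
def ArcExt (x y : ℕ × ℕ) : Prop := x.1 < y.1 ∧ y.1 ≤ x.2 ∧ x.2 < y.2

namespace LinearRep

open Abelian HomExt

variable {k : Type u} [Field k] {n : ℕ}

/-- Let `a` be the lowest vertex with a nonzero space and `c` the furthest one at which some vector
`x` of that space survives. Then `x` generates a copy of `[a, c + 1)`, and a functional with value 1
on the image of `x` at `c` gives the retraction. -/
lemma exists_retract_interval (V : LinearRep k n) (hV : ¬ IsZero V) :
    ∃ a b, a < b ∧ b ≤ n ∧ Nonempty (Retract (interval k n a b) V) := by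
  classical
  have h0 : ∃ a, ∃ h : a < n, ∃ x : V.obj (vtx a h), x ≠ 0 := by
    by_contra! h
    exact hV (isZero_of_forall fun i x => h (idx i) (idx_lt i) x)
  obtain ⟨ha, x0, hx0⟩ := Nat.find_spec h0
  have hmin := fun m => Nat.find_min h0 (m := m)
  set a := Nat.find h0
  let P : ℕ → Prop := fun c => ∃ (hc : c < n) (p : vtx a ha ⟶ vtx c hc) (x : V.obj (vtx a ha)),
    V.tr p x ≠ 0
  have hPa : P a := ⟨ha, 𝟙 _, x0, by rwa [tr_self]⟩
  obtain ⟨hc, p, x, hx⟩ := Nat.findGreatest_spec (P := P) ha.le hPa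
  have hmax : ∀ m, Nat.findGreatest P n < m → m ≤ n → ¬ P m := fun m h1 h2 =>
    Nat.findGreatest_is_greatest h1 h2
  set c := Nat.findGreatest P n
  have hac : a ≤ c := idx_le_of_hom p
  obtain ⟨φ, hφ⟩ : ∃ φ : V.obj (vtx c hc) →ₗ[k] k, φ (V.tr p x) = 1 := by
    have h1 : ¬ ∀ φ : Module.Dual k (V.obj (vtx c hc)), φ (V.tr p x) = 0 := fun h =>
      hx ((Module.forall_dual_apply_eq_zero_iff k _).1 h)
    obtain ⟨ψ, hψ⟩ := not_forall.1 h1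
    exact ⟨(ψ (V.tr p x))⁻¹ • ψ, by simp [hψ]⟩
  have hV0 : ∀ i, idx i < a → ∀ y : V.obj i, y = 0 := fun i hi y => by
    by_contra hy
    exact hmin _ hi ⟨idx_lt i, y, hy⟩
  refine ⟨a, c + 1, by omega, hc, ⟨⟨ofElt ha x fun j q hj => ?_, toIntervalHom hc hV0 φ, ?_⟩⟩⟩
  · by_contra hy
    exact hmax (idx j) hj (idx_lt j).le ⟨idx_lt j, q, x, hy⟩
  · refine interval_hom_ext ha (by omega) (coord_injective _ _ _ ?_)
    rw [cmp_comp, cmp_ofElt_gen, coord_toIntervalHom hc hV0 φ (vtx a ha) hac p, hφ]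
    rfl

lemma gen_ne_zero {a b : ℕ} (ha : a < n) (hab : a < b) : gen (k := k) a b ha hab ≠ 0 := fun h => by
  have := congrArg (coord a b _) h
  rw [map_zero, gen, coord_elt] at this
  exact one_ne_zero this

lemma id_interval_ne_zero {a b : ℕ} (hab : a < b) (hbn : b ≤ n) : 𝟙 (interval k n a b) ≠ 0 :=
  fun h => gen_ne_zero (k := k) (show a < n by omega) hab
    (congrArg (fun f => cmp f _ (gen a b (show a < n by omega) hab)) h)

/-- The idempotent that cuts out an interval summand is nonzero, hence the identity in a division
ring. -/
lemma exists_iso_interval {V : LinearRep k n} (hV : IsExceptional.{u + 1} V) :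
    ∃ x, IsArc n x ∧ Nonempty (V ≅ interval k n x.1 x.2) := by
  have hV0 : ¬ IsZero V := fun h => by
    have := hV.nontrivial
    exact not_subsingleton (End V) ⟨fun f g => h.eq_of_src f g⟩
  obtain ⟨a, b, hab, hbn, ⟨r⟩⟩ := exists_retract_interval V hV0
  refine ⟨(a, b), ⟨hab, hbn⟩, ⟨⟨r.r, r.i, ?_, r.retract⟩⟩⟩
  let e : End V := r.r ≫ r.i
  have he : e ≠ 0 := fun h => id_interval_ne_zero (k := k) hab hbn (by
    have h' : r.r ≫ r.i = 0 := h
    calc 𝟙 (interval k n a b) = r.i ≫ (r.r ≫ r.i) ≫ r.r := by simp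
      _ = 0 := by rw [h', zero_comp, comp_zero])
  have h2 : e * e = e := by
    change (r.r ≫ r.i) ≫ (r.r ≫ r.i) = r.r ≫ r.i
    simp
  exact (hV.isUnit e he).mul_left_cancel (h2.trans (mul_one e).symm)

/-- The total dimension of a representation. -/
noncomputable def dim (V : LinearRep k n) : ℕ :=
  ∑ i : Fin n, Module.finrank k (V.obj (vtx i.1 i.2))

lemma dim_lt {V W : LinearRep k n} (f : V ⟶ W) [Mono f] (a : ℕ) (ha : a < n)
    (h : ¬ Function.Surjective (cmp f (vtx a ha))) : dim V < dim W := by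
  have hinj := injective_of_mono f
  refine Finset.sum_lt_sum (fun i _ => LinearMap.finrank_le_finrank_of_injective (hinj _))
    ⟨⟨a, ha⟩, Finset.mem_univ _, lt_of_le_of_ne
      (LinearMap.finrank_le_finrank_of_injective (hinj _)) fun h' => h ?_⟩
  exact (LinearMap.injective_iff_surjective_of_finrank_eq_finrank h').1 (hinj _)

/-- The kernel of the projection to an interval summand is again a retract and has smaller
dimension. With membership in a perpendicular category as `Q`, this is an induction inside that
category. -/
theorem induction_on_intervals {Q P : LinearRep k n → Prop}
    (hQ : ∀ {X Y : LinearRep k n}, Retract X Y → Q Y → Q X)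
    (hzero : ∀ W, IsZero W → P W)
    (hint : ∀ a b, a < b → b ≤ n → Q (interval k n a b) → P (interval k n a b))
    (hext : ∀ S : ShortComplex (LinearRep k n), S.ShortExact → P S.X₁ → P S.X₃ → P S.X₂)
    (W : LinearRep k n) (hW : Q W) : P W := by
  induction hd : dim W using Nat.strong_induction_on generalizing W with
  | _ d ih =>
    by_cases h0 : IsZero W
    · exact hzero W h0
    obtain ⟨a, b, hab, hbn, ⟨r⟩⟩ := exists_retract_interval W h0
    have hr : Epi r.r := ⟨fun g g' h => by
      rw [← Category.id_comp g, ← Category.id_comp g', ← r.retract, Category.assoc,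
        Category.assoc, h]⟩
    have hS : (ShortComplex.mk _ _ (kernel.condition r.r)).ShortExact :=
      { exact := ShortComplex.exact_kernel _ }
    have rK : Retract (kernel r.r) W :=
      ⟨kernel.ι r.r, kernel.lift r.r (𝟙 W - r.r ≫ r.i) (by simp), by
        rw [← cancel_mono (kernel.ι r.r)]; simp⟩
    have hlt : dim (kernel r.r) < dim W := by
      refine dim_lt (kernel.ι r.r) a (by omega) fun hsurj => ?_
      have ha : a < n := by omega
      obtain ⟨y, hy⟩ := hsurj (cmp r.i _ (gen a b ha hab))
      have e := congrArg (cmp r.r _) hy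
      rw [← cmp_comp, ← cmp_comp, kernel.condition, r.retract] at e
      exact gen_ne_zero ha hab e.symm
    exact hext _ hS (ih _ (hd ▸ hlt) _ (hQ rK hW) rfl) (hint a b hab hbn (hQ r hW))

lemma subsingleton_ext_of_isZero_left {V W : LinearRep k n} (h : IsZero V) (i : ℕ) :
    Subsingleton (Ext.{u + 1} V W i) :=
  subsingleton_of_forall fun x => by
    rw [← Ext.mk₀_id_comp x, (IsZero.iff_id_eq_zero V).1 h, Ext.mk₀_zero, Ext.zero_comp]

lemma subsingleton_ext_of_isZero_right {V W : LinearRep k n} (h : IsZero W) (i : ℕ) :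
    Subsingleton (Ext.{u + 1} V W i) :=
  subsingleton_of_forall fun x => by
    rw [← Ext.comp_mk₀_id x, (IsZero.iff_id_eq_zero W).1 h, Ext.mk₀_zero, Ext.comp_zero]

lemma subsingleton_ext_two (V W : LinearRep k n) : Subsingleton (Ext.{u + 1} V W 2) :=
  induction_on_intervals (Q := fun _ => True) (P := fun V => Subsingleton (Ext.{u + 1} V W 2))
    (fun _ _ => trivial) (fun _ h => subsingleton_ext_of_isZero_left h 2)
    (fun _ _ hab hbn _ => subsingleton_ext_interval hab.le hbn W 0)
    (fun _ hS h₁ h₃ => contravariant₂ hS h₁ h₃) V trivial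

lemma vanish_iff_arcVanish {E E' : LinearRep k n} {x y : ℕ × ℕ} (hx : IsArc n x) (hy : IsArc n y)
    (e : E ≅ interval k n x.1 x.2) (e' : E' ≅ interval k n y.1 y.2) :
    HomExtVanish.{u + 1} E E' ↔ ArcVanish x y :=
  (vanish_congr e e').trans (vanish_interval_iff hx.1 hx.2 hy.2)

attribute [local instance] Abelian.hasFiniteBiproducts

-- Relative projectivity and injectivity in terms of arcs

section Relative

variable {J : Type} [Finite J] {E : J → LinearRep k n} {x : J → ℕ × ℕ} (hx : ∀ j, IsArc n (x j))
  (e : ∀ j, E j ≅ interval k n (x j).1 (x j).2)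
include hx e

lemma rightPerp_iff (y : ℕ × ℕ) (hy : IsArc n y) {M : LinearRep k n}
    (eM : M ≅ interval k n y.1 y.2) :
    rightPerp.{u + 1} (⨁ E) M ↔ ∀ j, ArcVanish (x j) y :=
  (vanish_biproduct_left E M).trans
    (forall_congr' fun j => vanish_iff_arcVanish (hx j) hy (e j) eM)

lemma leftPerp_iff (y : ℕ × ℕ) (hy : IsArc n y) {M : LinearRep k n}
    (eM : M ≅ interval k n y.1 y.2) :
    leftPerp.{u + 1} (⨁ E) M ↔ ∀ j, ArcVanish y (x j) :=
  (vanish_biproduct_right E M).trans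
    (forall_congr' fun j => vanish_iff_arcVanish hy (hx j) eM (e j))

/-- A perpendicular arc `z = (c, d)` that extends `y = (a, b)` yields a perpendicular `[a, d)`
mapping onto `[a, b)`, without a section because `Hom([a, b), [a, d)) = 0`. Conversely, `Ext¹`
vanishes on all perpendicular objects once it does on the interval modules among them. -/
theorem isRelProjectiveWrt_iff {y : ℕ × ℕ} (hy : IsArc n y) {M : LinearRep k n}
    (eM : M ≅ interval k n y.1 y.2) :
    IsRelProjectiveWrt.{u + 1} (⨁ E) M ↔ (∀ j, ArcVanish (x j) y) ∧
      ¬ ∃ z, IsArc n z ∧ (∀ j, ArcVanish (x j) z) ∧ ArcExt y z := by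
  constructor
  · rintro ⟨h, hproj⟩
    have hxy := (rightPerp_iff hx e y hy eM).1 h
    refine ⟨hxy, fun ⟨z, hz, hxz, hyz⟩ => ?_⟩
    obtain ⟨a, b⟩ := y
    obtain ⟨c, d⟩ := z
    dsimp only [IsArc, ArcExt] at hy hz hyz eM
    -- `[a, d)` is the union of `[a, b)` and `[c, d)`, which overlap or are adjacent; so it inherits
    -- the condition from both.
    have hN : rightPerp.{u + 1} (⨁ E) (interval k n a d) :=
      (rightPerp_iff hx e (a, d) ⟨show a < d by omega, hz.2⟩ (Iso.refl _)).2 fun j => by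
        have h1 := hxy j
        have h2 := hxz j
        dsimp only [ArcVanish] at h1 h2 ⊢
        omega
    let q : interval k n a d ⟶ interval k n a b := canHom a d a b le_rfl hyz.2.2.le
    have hq : Epi q := epi_of_surjective _ fun i y => by
      by_cases hi : a ≤ idx i ∧ idx i < b
      · refine ⟨elt a d i ⟨hi.1, by omega⟩ (coord a b i y), coord_injective _ _ _ ?_⟩
        rw [coord_canHom, if_pos hi, coord_elt]
      · exact ⟨0, by rw [map_zero, eq_zero_of_not a b i y hi]⟩
    let f : (⟨_, hN⟩ : (rightPerp.{u + 1} (⨁ E)).FullSubcategory) ⟶ ⟨M, h⟩ := ⟨q ≫ eM.inv⟩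
    have hf : Epi f := ⟨fun g g' hg => by
      ext1
      have : (q ≫ eM.inv) ≫ g.hom = (q ≫ eM.inv) ≫ g'.hom := congrArg (fun s => s.hom) hg
      exact (cancel_epi _).1 this⟩
    obtain ⟨s, hs⟩ := hproj.factors (𝟙 _) f
    have hs' : s.hom ≫ q ≫ eM.inv = 𝟙 M := congrArg (fun s => s.hom) hs
    have h0 : eM.inv ≫ s.hom = 0 := interval_hom_eq_zero hy.1 (by omega) hz.2 (by omega) _
    refine id_interval_ne_zero (k := k) hy.1 hy.2 ?_
    calc 𝟙 (interval k n a b) = eM.inv ≫ (s.hom ≫ q ≫ eM.inv) ≫ eM.hom := by rw [hs']; simp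
      _ = (eM.inv ≫ s.hom) ≫ q ≫ eM.inv ≫ eM.hom := by simp only [Category.assoc]
      _ = 0 := by rw [h0, zero_comp]
  · rintro ⟨hxy, hno⟩
    refine ⟨(rightPerp_iff hx e y hy eM).2 hxy, projective_of_ext subsingleton_ext_two _
      fun W hW => (subsingleton_congr eM (Iso.refl W)).2 ?_⟩
    refine induction_on_intervals (Q := rightPerp.{u + 1} (⨁ E))
      (P := fun W => Subsingleton (Ext.{u + 1} (interval k n y.1 y.2) W 1))
      (fun r h => vanish_of_retract_right r h)
      (fun _ h => subsingleton_ext_of_isZero_right h 1)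
      (fun c d hcd hdn hQ => (subsingleton_ext_one_iff hy.1 hy.2 hdn).2 fun h => hno
        ⟨(c, d), ⟨hcd, hdn⟩, (rightPerp_iff hx e (c, d) ⟨hcd, hdn⟩ (Iso.refl _)).1 hQ, h⟩)
      (fun _ hS h₁ h₃ => covariant₂ hS h₁ h₃) W hW

/-- The dual argument: `[a, b)` embeds into `[c, b)`, and `Hom([c, b), [a, b)) = 0` rules out a
retraction. -/
theorem isRelInjectiveWrt_iff {y : ℕ × ℕ} (hy : IsArc n y) {M : LinearRep k n}
    (eM : M ≅ interval k n y.1 y.2) :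
    IsRelInjectiveWrt.{u + 1} (⨁ E) M ↔ (∀ j, ArcVanish y (x j)) ∧
      ¬ ∃ z, IsArc n z ∧ (∀ j, ArcVanish z (x j)) ∧ ArcExt z y := by
  constructor
  · rintro ⟨h, hinj⟩
    have hxy := (leftPerp_iff hx e y hy eM).1 h
    refine ⟨hxy, fun ⟨z, hz, hxz, hyz⟩ => ?_⟩
    obtain ⟨a, b⟩ := y
    obtain ⟨c, d⟩ := z
    dsimp only [IsArc, ArcExt] at hy hz hyz eM
    have hN : leftPerp.{u + 1} (⨁ E) (interval k n c b) :=
      (leftPerp_iff hx e (c, b) ⟨show c < b by omega, hy.2⟩ (Iso.refl _)).2 fun j => by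
        have h1 := hxy j
        have h2 := hxz j
        dsimp only [ArcVanish] at h1 h2 ⊢
        omega
    let q : interval k n a b ⟶ interval k n c b := canHom a b c b hyz.1.le le_rfl
    have hq : Mono q := mono_of_injective _ fun i y y' hyy => by
      apply coord_injective
      have h := congrArg (coord c b i) hyy
      rw [coord_canHom, coord_canHom] at h
      by_cases hi : c ≤ idx i ∧ idx i < b
      · rwa [if_pos hi, if_pos hi] at h
      · rw [coord_eq_zero a b i y (by omega), coord_eq_zero a b i y' (by omega)]
    let f : (⟨M, h⟩ : (leftPerp.{u + 1} (⨁ E)).FullSubcategory) ⟶ ⟨_, hN⟩ := ⟨eM.hom ≫ q⟩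
    have hf : Mono f := ⟨fun g g' hg => by
      ext1
      have : g.hom ≫ (eM.hom ≫ q) = g'.hom ≫ (eM.hom ≫ q) := congrArg (fun s => s.hom) hg
      exact (cancel_mono _).1 this⟩
    obtain ⟨s, hs⟩ := hinj.factors (𝟙 _) f
    have hs' : (eM.hom ≫ q) ≫ s.hom = 𝟙 M := congrArg (fun s => s.hom) hs
    have h0 : s.hom ≫ eM.hom = 0 :=
      interval_hom_eq_zero (by omega) (by omega) hy.2 (by omega) _
    refine id_interval_ne_zero (k := k) hy.1 hy.2 ?_
    calc 𝟙 (interval k n a b) = eM.inv ≫ ((eM.hom ≫ q) ≫ s.hom) ≫ eM.hom := by rw [hs']; simp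
      _ = eM.inv ≫ eM.hom ≫ q ≫ s.hom ≫ eM.hom := by simp only [Category.assoc]
      _ = 0 := by rw [h0]; simp only [comp_zero]
  · rintro ⟨hxy, hno⟩
    refine ⟨(leftPerp_iff hx e y hy eM).2 hxy, injective_of_ext subsingleton_ext_two _
      fun W hW => (subsingleton_congr (Iso.refl W) eM).2 ?_⟩
    refine induction_on_intervals (Q := leftPerp.{u + 1} (⨁ E))
      (P := fun W => Subsingleton (Ext.{u + 1} W (interval k n y.1 y.2) 1))
      (fun r h => vanish_of_retract_left r h)
      (fun _ h => subsingleton_ext_of_isZero_left h 1)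
      (fun c d hcd hdn hQ => (subsingleton_ext_one_iff hcd hdn hy.2).2 fun h => hno
        ⟨(c, d), ⟨hcd, hdn⟩, (leftPerp_iff hx e (c, d) ⟨hcd, hdn⟩ (Iso.refl _)).1 hQ, h⟩)
      (fun _ hS h₁ h₃ => contravariant₂ hS h₁ h₃) W hW

end Relative

end LinearRep

/-! ### Noncrossing trees -/

/-- The weights `ρ` order the arcs of `S` in such a way that the condition of an exceptional
sequence holds. -/
def OrderedBy (S : Finset (ℕ × ℕ)) (ρ : ℕ × ℕ → ℤ) : Prop :=
  Set.InjOn ρ S ∧ ∀ x ∈ S, ∀ y ∈ S, ρ y < ρ x → ArcVanish x y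

/-- A set of arcs on the points `s, …, t` that can be ordered into an exceptional sequence. -/
structure Admissible (s t : ℕ) (S : Finset (ℕ × ℕ)) : Prop where
  le : s ≤ t
  arc : ∀ x ∈ S, s ≤ x.1 ∧ x.1 < x.2 ∧ x.2 ≤ t
  ordered : ∃ ρ, OrderedBy S ρ

/-- A complete exceptional set of arcs on the points `s, …, t`. -/
structure Complete (s t : ℕ) (S : Finset (ℕ × ℕ)) : Prop extends Admissible s t S where
  card : S.card = t - s

/-- The set of arcs `{(p, t)} ∪ A ∪ B ∪ C`. -/
def joinArcs (p t : ℕ) (A B C : Finset (ℕ × ℕ)) : Finset (ℕ × ℕ) := insert (p, t) (A ∪ B ∪ C)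

lemma mem_joinArcs {p t : ℕ} {A B C : Finset (ℕ × ℕ)} {x : ℕ × ℕ} :
    x ∈ joinArcs p t A B C ↔ x = (p, t) ∨ x ∈ A ∨ x ∈ B ∨ x ∈ C := by
  simp [joinArcs]

lemma Admissible.mono {s t s' t' : ℕ} {S S' : Finset (ℕ × ℕ)} (h : Admissible s t S)
    (hS : S' ⊆ S) (hle : s' ≤ t') (harc : ∀ x ∈ S', s' ≤ x.1 ∧ x.2 ≤ t') :
    Admissible s' t' S' := by
  obtain ⟨ρ, h1, h2⟩ := h.ordered
  exact ⟨hle, fun x hx => ⟨(harc x hx).1, (h.arc x (hS hx)).2.1, (harc x hx).2⟩,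
    ρ, h1.mono (by exact_mod_cast hS), fun x hx y hy => h2 x (hS hx) y (hS hy)⟩

/-- The arcs other than the longest arc `(p, t)` that ends in the last point fall into three
classes. -/
lemma Admissible.exists_cut {s t p : ℕ} {S : Finset (ℕ × ℕ)} (h : Admissible s t S)
    (hp : (p, t) ∈ S) (hmin : ∀ p', (p', t) ∈ S → p ≤ p') :
    ∃ q, p ≤ q ∧ q < t ∧ ∀ y ∈ S, y ≠ (p, t) →
      y.2 ≤ p ∨ (p ≤ y.1 ∧ y.2 ≤ q) ∨ q + 1 ≤ y.1 := by
  classical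
  obtain ⟨ρ, hinj, hρ⟩ := h.ordered
  have hpt := h.arc _ hp
  dsimp only at hpt
  -- No support contains the last point `t`, so the support of an arc before `(p, t)` cannot contain
  -- `p`.
  have early : ∀ y ∈ S, ρ y < ρ (p, t) → y.2 ≤ p ∨ p < y.1 := fun y hy hlt => by
    have h1 := hρ _ hp y hy hlt
    have h2 := h.arc y hy
    dsimp only [ArcVanish] at h1
    omega
  -- A later arc that starts left of `p` ends before `p` or at `t`, and minimality of `p` excludes
  -- the latter.
  have late : ∀ y ∈ S, ρ (p, t) < ρ y → y.2 ≤ p ∨ (p ≤ y.1 ∧ y.2 < t) := fun y hy hlt => by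
    have h1 := hρ y hy _ hp hlt
    have h2 := h.arc y hy
    have h3 : y.2 = t → p ≤ y.1 := fun e => hmin y.1 (by rw [← e]; exact hy)
    dsimp only [ArcVanish] at h1
    omega
  -- No later arc from `p` on may straddle a cut; `q` is the least cut.
  let IsCut : ℕ → Prop := fun q => p ≤ q ∧ ∀ y ∈ S, ρ (p, t) < ρ y → p ≤ y.1 →
    y.2 ≤ q ∨ q < y.1
  have hex : IsCut (t - 1) := ⟨by omega, fun y hy hlt hpy => by
    have h2 := h.arc y hy
    have := late y hy hlt
    omega⟩
  obtain ⟨hpq, hq⟩ := Nat.find_spec ⟨t - 1, hex⟩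
  have hlow := fun m => Nat.find_min (⟨t - 1, hex⟩ : ∃ q, IsCut q) (m := m)
  have hqt := Nat.find_le (h := ⟨t - 1, hex⟩) hex
  set q := Nat.find (⟨t - 1, hex⟩ : ∃ q, IsCut q)
  refine ⟨q, hpq, by omega, fun y hy hne => ?_⟩
  have hya := h.arc y hy
  rcases lt_trichotomy (ρ y) (ρ (p, t)) with hlt | heq | hlt
  · rcases early y hy hlt with h1 | h1
    · exact Or.inl h1
    by_contra hcon
    -- Since `y.1 - 1` is not a cut, some later arc `z` satisfies `z.1 < y.1 ≤ z.2`, and `z.2 ≤ q`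
    -- because `q` is a cut. The order of `y` and `z` then forces `y.2 ≤ z.2`, so `y` stays within
    -- `p, …, q`.
    have hnc := hlow (y.1 - 1) (by omega)
    simp only [IsCut, not_and, not_forall] at hnc
    obtain ⟨z, hz, hzl, hpz, hzc⟩ := hnc (by omega)
    have h2 := hq z hz hzl hpz
    have h3 := hρ z hz y hy (hlt.trans hzl)
    dsimp only [ArcVanish] at h3
    omega
  · exact absurd (hinj hy hp heq) hne
  · rcases late y hy hlt with h1 | h1
    · exact Or.inl h1
    · have := hq y hy hlt h1.1
      omega

lemma Admissible.exists_split {s t : ℕ} {S : Finset (ℕ × ℕ)} (h : Admissible s t S)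
    (hend : ∃ p, (p, t) ∈ S) : ∃ p q A B C, s ≤ p ∧ p ≤ q ∧ q < t ∧ Admissible s p A ∧
      Admissible p q B ∧ Admissible (q + 1) t C ∧ S = joinArcs p t A B C := by
  classical
  have hp := Nat.find_spec hend
  have hmin : ∀ p', (p', t) ∈ S → Nat.find hend ≤ p' := fun p' h' => Nat.find_le h'
  set p := Nat.find hend
  have hpt := h.arc _ hp
  dsimp only at hpt
  obtain ⟨q, hpq, hqt, hcut⟩ := h.exists_cut hp hmin
  refine ⟨p, q, S.filter fun y => y.2 ≤ p, S.filter fun y => p ≤ y.1 ∧ y.2 ≤ q,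
    S.filter fun y => q + 1 ≤ y.1, hpt.1, hpq, hqt, ?_, ?_, ?_, ?_⟩
  · exact h.mono (Finset.filter_subset _ _) hpt.1 fun x hx => by
      rw [Finset.mem_filter] at hx
      exact ⟨(h.arc x hx.1).1, hx.2⟩
  · exact h.mono (Finset.filter_subset _ _) hpq fun x hx => (Finset.mem_filter.1 hx).2
  · exact h.mono (Finset.filter_subset _ _) hqt fun x hx => by
      rw [Finset.mem_filter] at hx
      exact ⟨hx.2, (h.arc x hx.1).2.2⟩
  · ext y
    simp only [mem_joinArcs, Finset.mem_filter]
    constructor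
    · intro hy
      by_cases hne : y = (p, t)
      · exact Or.inl hne
      · have := hcut y hy hne
        tauto
    · rintro (rfl | h | h | h)
      exacts [hp, h.1, h.1, h.1]

/-- The splitting arc and its three pieces account for at most `1 + (p - s) + (q - p) + (t - q - 1)
= t - s` arcs. Equality then forces the pieces of a complete set to be complete. -/
lemma Admissible.card_le {s t : ℕ} {S : Finset (ℕ × ℕ)} (h : Admissible s t S) :
    S.card ≤ t - s := by
  induction hd : t - s using Nat.strong_induction_on generalizing s t S with
  | _ d ih =>
    by_cases hend : ∃ p, (p, t) ∈ S
    · obtain ⟨p, q, A, B, C, hsp, hpq, hqt, hA, hB, hC, rfl⟩ := h.exists_split hend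
      have h1 := ih _ (by omega) hA rfl
      have h2 := ih _ (by omega) hB rfl
      have h3 := ih _ (by omega) hC rfl
      have h4 := Finset.card_insert_le (p, t) (A ∪ B ∪ C)
      have h5 := Finset.card_union_le (A ∪ B) C
      have h6 := Finset.card_union_le A B
      unfold joinArcs
      omega
    · have hlt : ∀ x ∈ S, x.2 < t := fun x hx => by
        have := h.arc x hx
        rcases this.2.2.lt_or_eq with h' | h'
        · exact h'
        · exact absurd ⟨x.1, by rw [← h']; exact hx⟩ hend
      rcases S.eq_empty_or_nonempty with rfl | ⟨x, hx⟩
      · simp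
      · have hx1 := h.arc x hx
        have := hlt x hx
        have := ih _ (by omega) (h.mono (s' := s) (t' := t - 1) le_rfl (by omega)
          fun y hy => ⟨(h.arc y hy).1, by have := hlt y hy; omega⟩) rfl
        omega

lemma Complete.exists_split {s t : ℕ} {S : Finset (ℕ × ℕ)} (h : Complete s t S) (hst : s < t) :
    ∃ p q A B C, s ≤ p ∧ p ≤ q ∧ q < t ∧ Complete s p A ∧ Complete p q B ∧
      Complete (q + 1) t C ∧ S = joinArcs p t A B C := by
  -- With no arc ending at `t`, the arcs would live on `s, …, t - 1` and be too few.
  have hend : ∃ p, (p, t) ∈ S := by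
    by_contra hend
    have hlt : ∀ x ∈ S, x.2 < t := fun x hx => by
      rcases (h.arc x hx).2.2.lt_or_eq with h' | h'
      · exact h'
      · exact absurd ⟨x.1, by rw [← h']; exact hx⟩ hend
    have h1 := (h.toAdmissible.mono (s' := s) (t' := t - 1) le_rfl (by omega)
      fun y hy => ⟨(h.arc y hy).1, by have := hlt y hy; omega⟩).card_le
    have := h.card
    omega
  obtain ⟨p, q, A, B, C, hsp, hpq, hqt, hA, hB, hC, rfl⟩ := h.toAdmissible.exists_split hend
  have h1 := hA.card_le
  have h2 := hB.card_le
  have h3 := hC.card_le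
  have h4 := Finset.card_insert_le (p, t) (A ∪ B ∪ C)
  have h5 := Finset.card_union_le (A ∪ B) C
  have h6 := Finset.card_union_le A B
  have h7 := h.card
  unfold joinArcs at h7
  exact ⟨p, q, A, B, C, hsp, hpq, hqt, ⟨hA, by omega⟩, ⟨hB, by omega⟩, ⟨hC, by omega⟩, rfl⟩

lemma Complete.eq_empty {s : ℕ} {S : Finset (ℕ × ℕ)} (h : Complete s s S) : S = ∅ :=
  Finset.card_eq_zero.1 (h.card.trans (Nat.sub_self s))

lemma complete_empty (s : ℕ) : Complete s s ∅ :=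
  ⟨⟨le_rfl, by simp, fun _ => 0, by simp, by simp⟩, by simp⟩

/-- Induction along the decomposition of complete exceptional sets. -/
theorem Complete.induction {motive : ℕ → ℕ → Finset (ℕ × ℕ) → Prop}
    (base : ∀ s, motive s s ∅)
    (join : ∀ s p q t A B C, s ≤ p → p ≤ q → q < t → Complete s p A → Complete p q B →
      Complete (q + 1) t C → motive s p A → motive p q B → motive (q + 1) t C →
      motive s t (joinArcs p t A B C))
    {s t : ℕ} {S : Finset (ℕ × ℕ)} (h : Complete s t S) : motive s t S := by
  induction hd : t - s using Nat.strong_induction_on generalizing s t S with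
  | _ d ih =>
    rcases h.le.eq_or_lt with rfl | hst
    · rw [h.eq_empty]
      exact base s
    · obtain ⟨p, q, A, B, C, hsp, hpq, hqt, hA, hB, hC, rfl⟩ := h.exists_split hst
      exact join s p q t A B C hsp hpq hqt hA hB hC (ih _ (by omega) hA rfl)
        (ih _ (by omega) hB rfl) (ih _ (by omega) hC rfl)

/-- A complete exceptional set connects all points. -/
lemma Complete.connected {s t : ℕ} {S : Finset (ℕ × ℕ)} (h : Complete s t S) :
    ∀ P : ℕ → Prop, (∀ y ∈ S, (P y.1 ↔ P y.2)) → ∀ v, s ≤ v → v ≤ t → (P v ↔ P s) := by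
  refine Complete.induction (motive := fun s t S => ∀ P : ℕ → Prop,
    (∀ y ∈ S, (P y.1 ↔ P y.2)) → ∀ v, s ≤ v → v ≤ t → (P v ↔ P s)) ?_ ?_ h
  · intro s P _ v h1 h2
    rw [le_antisymm h2 h1]
  · intro s p q t A B C hsp hpq hqt _ _ _ ihA ihB ihC P hP v h1 h2
    simp only [mem_joinArcs] at hP
    have hA := ihA P fun y hy => hP y (Or.inr (Or.inl hy))
    have hB := ihB P fun y hy => hP y (Or.inr (Or.inr (Or.inl hy)))
    have hC := ihC P fun y hy => hP y (Or.inr (Or.inr (Or.inr hy)))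
    have h0 : P p ↔ P t := hP (p, t) (Or.inl rfl)
    have hp := hA p hsp le_rfl
    by_cases h3 : v ≤ p
    · exact hA v h1 h3
    by_cases h4 : v ≤ q
    · exact (hB v (by omega) h4).trans hp
    · exact (hC v (by omega) h2).trans ((hC t (by omega) le_rfl).symm.trans (h0.symm.trans hp))

/-- All of `T` is placed after all of `S`, so the mixed conditions are needed in one direction only.
-/
lemma ordered_union {S T : Finset (ℕ × ℕ)} (hS : ∃ ρ, OrderedBy S ρ) (hT : ∃ ρ, OrderedBy T ρ)
    (h : ∀ x ∈ T, ∀ y ∈ S, ArcVanish x y) : ∃ ρ, OrderedBy (S ∪ T) ρ := by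
  classical
  obtain ⟨ρ, h1, h2⟩ := hS
  obtain ⟨σ, h3, h4⟩ := hT
  -- `M` bounds the differences of weights, so raising `σ` by `M + 1` puts `T` above `S`.
  obtain ⟨M, hM⟩ := ((S ×ˢ T).image fun z => ρ z.1 - σ z.2).exists_le
  have hM' : ∀ x ∈ S, ∀ y ∈ T, ρ x < σ y + (M + 1) := fun x hx y hy => by
    have := hM (ρ x - σ y) (Finset.mem_image.2 ⟨(x, y), by simp [hx, hy], rfl⟩)
    omega
  have hl : ∀ x ∈ S, (if x ∈ S then ρ x else σ x + (M + 1)) = ρ x := fun x hx => if_pos hx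
  have hr : ∀ x, x ∉ S → (if x ∈ S then ρ x else σ x + (M + 1)) = σ x + (M + 1) :=
    fun x hx => if_neg hx
  have hmem : ∀ x, x ∈ S ∪ T → x ∉ S → x ∈ T := fun x hx hn =>
    (Finset.mem_union.1 hx).resolve_left hn
  refine ⟨fun x => if x ∈ S then ρ x else σ x + (M + 1), fun x hx y hy hxy => ?_,
    fun x hx y hy hxy => ?_⟩
  · rw [Finset.mem_coe] at hx hy
    dsimp only at hxy
    by_cases hxS : x ∈ S <;> by_cases hyS : y ∈ S
    · rw [hl x hxS, hl y hyS] at hxy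
      exact h1 hxS hyS hxy
    · rw [hl x hxS, hr y hyS] at hxy
      exact absurd hxy (hM' x hxS y (hmem y hy hyS)).ne
    · rw [hr x hxS, hl y hyS] at hxy
      exact absurd hxy (hM' y hyS x (hmem x hx hxS)).ne'
    · rw [hr x hxS, hr y hyS] at hxy
      exact h3 (hmem x hx hxS) (hmem y hy hyS) (by omega)
  · dsimp only at hxy
    by_cases hxS : x ∈ S <;> by_cases hyS : y ∈ S
    · rw [hl x hxS, hl y hyS] at hxy
      exact h2 x hxS y hyS hxy
    · rw [hl x hxS, hr y hyS] at hxy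
      exact absurd hxy (hM' x hxS y (hmem y hy hyS)).not_gt
    · exact h x (hmem x hx hxS) y hyS
    · rw [hr x hxS, hr y hyS] at hxy
      exact h4 x (hmem x hx hxS) y (hmem y hy hyS) (by omega)

lemma sum_joinArcs {s p q t : ℕ} {A B C : Finset (ℕ × ℕ)} (hpq : p ≤ q)
    (hqt : q < t) (hA : Admissible s p A) (hB : Admissible p q B) (hC : Admissible (q + 1) t C)
    (f : ℕ × ℕ → ℕ) : ∑ x ∈ joinArcs p t A B C, f x =
      f (p, t) + (∑ x ∈ A, f x + ∑ x ∈ B, f x + ∑ x ∈ C, f x) := by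
  rw [joinArcs, Finset.sum_insert, Finset.sum_union, Finset.sum_union]
  · exact Finset.disjoint_left.2 fun x h1 h2 => by
      have := hA.arc x h1; have := hB.arc x h2; omega
  · refine Finset.disjoint_left.2 fun x h1 h2 => ?_
    have := hC.arc x h2
    rcases Finset.mem_union.1 h1 with h1 | h1
    · have := hA.arc x h1; omega
    · have := hB.arc x h1; omega
  · intro h
    simp only [Finset.mem_union] at h
    rcases h with (h | h) | h
    · have := hA.arc _ h; dsimp only at this; omega
    · have := hB.arc _ h; dsimp only at this; omega
    · have := hC.arc _ h; dsimp only at this; omega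

theorem Complete.join {s p q t : ℕ} {A B C : Finset (ℕ × ℕ)} (hsp : s ≤ p) (hpq : p ≤ q)
    (hqt : q < t) (hA : Complete s p A) (hB : Complete p q B) (hC : Complete (q + 1) t C) :
    Complete s t (joinArcs p t A B C) := by
  refine ⟨⟨by omega, fun x hx => ?_, ?_⟩, ?_⟩
  · rcases mem_joinArcs.1 hx with rfl | h | h | h
    · dsimp only; omega
    · have := hA.arc x h; omega
    · have := hB.arc x h; omega
    · have := hC.arc x h; omega
  -- The order is `A`, `C`, `(p, t)`, `B`: supports in `A` and `C` contain neither `p` nor `t`,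
  -- while the support of `(p, t)` contains both ends of every arc of `B`.
  · have e : joinArcs p t A B C = ((A ∪ C) ∪ {(p, t)}) ∪ B := by
      ext x; simp only [mem_joinArcs, Finset.mem_union, Finset.mem_singleton]; tauto
    rw [e]
    refine ordered_union (ordered_union (ordered_union hA.ordered hC.ordered ?_)
      ⟨fun _ => 0, by simp, by simp⟩ ?_) hB.ordered ?_
    · intro x hx y hy
      have := hC.arc x hx
      have := hA.arc y hy
      dsimp only [ArcVanish]; omega
    · intro x hx y hy
      rw [Finset.mem_singleton] at hx
      subst hx
      rcases Finset.mem_union.1 hy with hy | hy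
      · have := hA.arc y hy
        dsimp only [ArcVanish]; omega
      · have := hC.arc y hy
        dsimp only [ArcVanish]; omega
    · intro x hx y hy
      have := hB.arc x hx
      simp only [Finset.mem_union, Finset.mem_singleton] at hy
      rcases hy with (hy | hy) | rfl
      · have := hA.arc y hy
        dsimp only [ArcVanish]; omega
      · have := hC.arc y hy
        dsimp only [ArcVanish]; omega
      · dsimp only [ArcVanish]; omega
  · have h := sum_joinArcs hpq hqt hA.toAdmissible hB.toAdmissible hC.toAdmissible fun _ => 1
    simp only [← Finset.card_eq_sum_ones, hA.card, hB.card, hC.card] at h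
    omega

/-- `p` is the least start of an arc ending at `t`. Apart from `(p, t)`, no arc joins the points up
to `q` to those beyond, so the connected set `B'` cannot reach past `q`; by symmetry `q = q'`.
Position then separates the three pieces. -/
theorem joinArcs_injective {s p q p' q' t : ℕ} {A B C A' B' C' : Finset (ℕ × ℕ)}
    (hpq : p ≤ q) (hqt : q < t) (hpq' : p' ≤ q') (hqt' : q' < t)
    (hA : Complete s p A) (hB : Complete p q B) (hC : Complete (q + 1) t C)
    (hA' : Complete s p' A') (hB' : Complete p' q' B') (hC' : Complete (q' + 1) t C')
    (h : joinArcs p t A B C = joinArcs p' t A' B' C') :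
    p = p' ∧ q = q' ∧ A = A' ∧ B = B' ∧ C = C' := by
  have hle : ∀ {p q p' q' : ℕ} {A B C A' B' C' : Finset (ℕ × ℕ)}, p ≤ q → q < t →
      Complete s p A → Complete p q B → Complete (q + 1) t C →
      joinArcs p t A B C = joinArcs p' t A' B' C' → p ≤ p' := by
    intro p q p' q' A B C A' B' C' hpq hqt hA hB hC h
    have hm : (p', t) ∈ joinArcs p t A B C := h ▸ mem_joinArcs.2 (Or.inl rfl)
    rcases mem_joinArcs.1 hm with h | h | h | h
    · exact (congrArg Prod.fst h).ge
    · have := hA.arc _ h; dsimp only at this; omega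
    · have := hB.arc _ h; dsimp only at this; omega
    · have := hC.arc _ h; dsimp only at this; omega
  obtain rfl : p = p' := le_antisymm (hle (q' := q') hpq hqt hA hB hC h)
    (hle (q' := q) hpq' hqt' hA' hB' hC' h.symm)
  have hle' : ∀ {q q' : ℕ} {A B C A' B' C' : Finset (ℕ × ℕ)}, p ≤ q → p ≤ q' → q' < t →
      Complete s p A → Complete p q B → Complete (q + 1) t C → Complete p q' B' →
      joinArcs p t A B C = joinArcs p t A' B' C' → q' ≤ q := by
    intro q q' A B C A' B' C' hpq hpq' hqt' hA hB hC hB' h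
    refine (hB'.connected (fun v => v ≤ q) (fun y hy => ?_) q' hpq' le_rfl).2 hpq
    have hm : y ∈ joinArcs p t A B C := h ▸ mem_joinArcs.2 (Or.inr (Or.inr (Or.inl hy)))
    have := hB'.arc y hy
    change y.1 ≤ q ↔ y.2 ≤ q
    rcases mem_joinArcs.1 hm with h | h | h | h
    · have := congrArg Prod.snd h; dsimp only at this; omega
    · have := hA.arc _ h; omega
    · have := hB.arc _ h; omega
    · have := hC.arc _ h; omega
  obtain rfl : q = q' := le_antisymm (hle' hpq' hpq hqt hA' hB' hC' hB h.symm)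
    (hle' hpq hpq' hqt' hA hB hC hB' h)
  have hsub : ∀ {A B C A' B' C' : Finset (ℕ × ℕ)},
      Complete s p A → Complete p q B → Complete (q + 1) t C →
      Complete s p A' → Complete p q B' → Complete (q + 1) t C' →
      joinArcs p t A B C = joinArcs p t A' B' C' → A ⊆ A' ∧ B ⊆ B' ∧ C ⊆ C' := by
    intro A B C A' B' C' hA hB hC hA' hB' hC' h
    have key : ∀ y, (y ∈ A ∨ y ∈ B ∨ y ∈ C) → y = (p, t) ∨ y ∈ A' ∨ y ∈ B' ∨ y ∈ C' :=
      fun y hy => mem_joinArcs.1 (h ▸ mem_joinArcs.2 (Or.inr hy))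
    refine ⟨fun y hy => ?_, fun y hy => ?_, fun y hy => ?_⟩
    · have h0 := hA.arc y hy
      rcases key y (Or.inl hy) with rfl | h | h | h
      · dsimp only at h0; omega
      · exact h
      · have := hB'.arc y h; omega
      · have := hC'.arc y h; omega
    · have h0 := hB.arc y hy
      rcases key y (Or.inr (Or.inl hy)) with rfl | h | h | h
      · dsimp only at h0; omega
      · have := hA'.arc y h; omega
      · exact h
      · have := hC'.arc y h; omega
    · have h0 := hC.arc y hy
      rcases key y (Or.inr (Or.inr hy)) with rfl | h | h | h
      · dsimp only at h0; omega
      · have := hA'.arc y h; omega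
      · have := hB'.arc y h; omega
      · exact h
  have h1 := hsub hA hB hC hA' hB' hC' h
  have h2 := hsub hA' hB' hC' hA hB hC h.symm
  exact ⟨rfl, rfl, h1.1.antisymm h2.1, h1.2.1.antisymm h2.2.1, h1.2.2.antisymm h2.2.2⟩

/-! ### Relatively projective arcs -/

/-- The arcs of `S` that are not relatively projective, in a form independent of the ordering. -/
def NonProj (n : ℕ) (S : Finset (ℕ × ℕ)) (e : ℕ × ℕ) : Prop :=
  ∃ z : ℕ × ℕ, z.2 ≤ n ∧ ArcExt e z ∧ ∀ y ∈ S, y ≠ e → ArcVanish y z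

/-- Among the witnesses `(c, d)` that respect the arcs after `e`, take one with least `d` and then
least `c`. If it fails for an arc `y` before `e`, then the difference, the intersection or the union
of `[c, d)` and `[y.1, y.2)` is a smaller witness, as the arcs after `e` respect both intervals. -/
theorem nonProj_iff_of_orderedBy {n : ℕ} {S : Finset (ℕ × ℕ)} {ρ : ℕ × ℕ → ℤ}
    (hρ : OrderedBy S ρ) (hS : ∀ x ∈ S, x.1 < x.2) {e : ℕ × ℕ} (he : e ∈ S) :
    (∃ z : ℕ × ℕ, z.2 ≤ n ∧ ArcExt e z ∧ ∀ y ∈ S, ρ e < ρ y → ArcVanish y z) ↔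
      NonProj n S e := by
  classical
  constructor
  swap
  · rintro ⟨z, h1, h2, h3⟩
    exact ⟨z, h1, h2, fun y hy hlt => h3 y hy (by rintro rfl; exact lt_irrefl _ hlt)⟩
  rintro ⟨z, h1, h2, h3⟩
  let Ok : ℕ → ℕ → Prop := fun d c => d ≤ n ∧ ArcExt e (c, d) ∧
    ∀ y ∈ S, ρ e < ρ y → ArcVanish y (c, d)
  have hd : ∃ d c, Ok d c := ⟨z.2, z.1, h1, h2, h3⟩
  have hc := Nat.find_spec hd
  have hdmin := fun m => Nat.find_min hd (m := m)
  set d := Nat.find hd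
  obtain ⟨hdn, hext, hlate⟩ := Nat.find_spec hc
  have hcmin := fun m => Nat.find_min hc (m := m)
  set c := Nat.find hc
  refine ⟨(c, d), hdn, hext, fun y hy hne => ?_⟩
  rcases lt_trichotomy (ρ y) (ρ e) with hlt | heq | hlt
  · have hy1 := hS y hy
    have hey := hρ.2 e he y hy hlt
    have hly : ∀ x ∈ S, ρ e < ρ x → ArcVanish x y := fun x hx hx' =>
      hρ.2 x hx y hy (hlt.trans hx')
    by_contra hcon
    dsimp only [ArcVanish, ArcExt] at hcon hext hey
    by_cases hin : c ≤ y.1 ∧ y.1 < d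
    · have hye : e.2 < y.1 := by omega
      refine hdmin y.1 hin.2 ⟨c, by omega, by dsimp only [ArcExt]; omega, fun x hx hx' => ?_⟩
      have h4 := hlate x hx hx'
      have h5 := hly x hx hx'
      have h6 := hS x hx
      dsimp only [ArcVanish] at h4 h5 ⊢
      omega
    · have hy2 : c ≤ y.2 ∧ y.2 < d := by tauto
      by_cases hey2 : e.2 < y.2
      · refine hdmin y.2 hy2.2 ⟨c, by omega, by dsimp only [ArcExt]; omega, fun x hx hx' => ?_⟩
        have h4 := hlate x hx hx'
        have h5 := hly x hx hx'
        have h6 := hS x hx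
        dsimp only [ArcVanish] at h4 h5 ⊢
        omega
      · have h7 := hS e he
        refine hcmin y.1 (by omega) ⟨hdn, by dsimp only [ArcExt]; omega, fun x hx hx' => ?_⟩
        have h4 := hlate x hx hx'
        have h5 := hly x hx hx'
        have h6 := hS x hx
        dsimp only [ArcVanish] at h4 h5 ⊢
        omega
  · exact absurd (hρ.1 hy he heq) hne
  · exact hlate y hy hlt

/-- The mirror image of `NonProj` for arcs on the points from `s` on. -/
def CononProj (s : ℕ) (S : Finset (ℕ × ℕ)) (e : ℕ × ℕ) : Prop :=
  ∃ z : ℕ × ℕ, s < z.1 ∧ z.1 ≤ e.1 ∧ e.1 < z.2 ∧ z.2 ≤ e.2 ∧ ∀ y ∈ S, y ≠ e → ArcVanish y z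

-- Relative projectivity in a joined set of arcs

section Join

variable {s p q t : ℕ} {A B C : Finset (ℕ × ℕ)}

lemma forall_joinArcs_ne_iff {P : ℕ × ℕ → Prop} {e : ℕ × ℕ} :
    (∀ y ∈ joinArcs p t A B C, y ≠ e → P y) ↔ ((p, t) ≠ e → P (p, t)) ∧
      (∀ y ∈ A, y ≠ e → P y) ∧ (∀ y ∈ B, y ≠ e → P y) ∧ (∀ y ∈ C, y ≠ e → P y) := by
  simp only [mem_joinArcs, or_imp, forall_and, forall_eq]

lemma nonProj_join_self : ¬ NonProj t (joinArcs p t A B C) (p, t) := by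
  rintro ⟨z, h1, h2, -⟩
  dsimp only [ArcExt] at h2
  omega

/-- No witness contains `t`, so the arc `(p, t)` forbids it to contain `p`; a witness for an arc of
`A` therefore ends by `p`. -/
lemma nonProj_join_left (hpq : p ≤ q) (hqt : q < t)
    (hA : Admissible s p A) (hB : Admissible p q B) (hC : Admissible (q + 1) t C) {e : ℕ × ℕ} (he : e ∈ A) :
    NonProj t (joinArcs p t A B C) e ↔ NonProj p A e := by
  have hae := hA.arc e he
  constructor
  · rintro ⟨z, h1, h2, h3⟩
    rw [forall_joinArcs_ne_iff] at h3
    have h4 := h3.1 (by rintro rfl; dsimp only at hae; omega)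
    dsimp only [ArcExt, ArcVanish] at h2 h4
    exact ⟨z, by omega, h2, h3.2.1⟩
  · rintro ⟨z, h1, h2, h3⟩
    dsimp only [ArcExt] at h2
    refine ⟨z, by omega, h2, ?_⟩
    rw [forall_joinArcs_ne_iff]
    refine ⟨fun _ => ?_, h3, fun y hy _ => ?_, fun y hy _ => ?_⟩
    · dsimp only [ArcVanish]; omega
    · have := hB.arc y hy; dsimp only [ArcVanish]; omega
    · have := hC.arc y hy; dsimp only [ArcVanish]; omega

/-- A witness for an arc of `C` starts beyond `q + 1` and ends by `t`, where it meets neither `(p,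
t)` nor `A` nor `B`. -/
lemma nonProj_join_right (hpq : p ≤ q)
    (hA : Admissible s p A) (hB : Admissible p q B) (hC : Admissible (q + 1) t C) {e : ℕ × ℕ} (he : e ∈ C) :
    NonProj t (joinArcs p t A B C) e ↔ NonProj t C e := by
  have hae := hC.arc e he
  constructor
  · rintro ⟨z, h1, h2, h3⟩
    rw [forall_joinArcs_ne_iff] at h3
    exact ⟨z, h1, h2, h3.2.2.2⟩
  · rintro ⟨z, h1, h2, h3⟩
    refine ⟨z, h1, h2, ?_⟩
    dsimp only [ArcExt] at h2
    rw [forall_joinArcs_ne_iff]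
    refine ⟨fun _ => ?_, fun y hy _ => ?_, fun y hy _ => ?_, h3⟩
    · dsimp only [ArcVanish]; omega
    · have := hA.arc y hy; dsimp only [ArcVanish]; omega
    · have := hB.arc y hy; dsimp only [ArcVanish]; omega

/-- `B` is attached at `p` and not at its last point, so a witness may contain `q`: hence the bound
`q + 1`. Whatever it contains beyond `q` is invisible to `B` and is cut off. -/
lemma nonProj_join_middle (hqt : q < t)
    (hA : Admissible s p A) (hB : Admissible p q B) (hC : Admissible (q + 1) t C) {e : ℕ × ℕ} (he : e ∈ B) :
    NonProj t (joinArcs p t A B C) e ↔ NonProj (q + 1) B e := by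
  have hae := hB.arc e he
  constructor
  · rintro ⟨z, h1, h2, h3⟩
    rw [forall_joinArcs_ne_iff] at h3
    dsimp only [ArcExt] at h2
    refine ⟨(z.1, min z.2 (q + 1)), min_le_right _ _, by dsimp only [ArcExt]; omega,
      fun y hy hne => ?_⟩
    have := hB.arc y hy
    have h4 := h3.2.2.1 y hy hne
    dsimp only [ArcVanish] at h4 ⊢
    omega
  · rintro ⟨z, h1, h2, h3⟩
    dsimp only [ArcExt] at h2
    refine ⟨z, by omega, h2, ?_⟩
    rw [forall_joinArcs_ne_iff]
    refine ⟨fun _ => ?_, fun y hy _ => ?_, h3, fun y hy _ => ?_⟩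
    · dsimp only [ArcVanish]; omega
    · have := hA.arc y hy; dsimp only [ArcVanish]; omega
    · have := hC.arc y hy; dsimp only [ArcVanish]; omega

end Join

/-- Deleting `e` from a noncrossing tree leaves two components, and the one without `s` is an
interval. It contains the right end of `e` in the first case and the left end in the second. -/
lemma Complete.nonProj_or_cononProj {s t : ℕ} {S : Finset (ℕ × ℕ)} (h : Complete s t S) :
    ∀ e ∈ S, NonProj (t + 1) S e ∨ CononProj s S e := by
  refine Complete.induction (motive := fun s t S =>
    ∀ e ∈ S, NonProj (t + 1) S e ∨ CononProj s S e) (by simp) ?_ h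
  intro s p q t A B C hsp hpq hqt hA hB hC ihA ihB ihC e he
  have aA := hA.arc
  have aB := hB.arc
  have aC := hC.arc
  have key := fun P : ℕ × ℕ → Prop => forall_joinArcs_ne_iff (p := p) (t := t)
    (A := A) (B := B) (C := C) (P := P) (e := e)
  simp only [NonProj, CononProj, key]
  rcases mem_joinArcs.1 he with rfl | he | he | he
  -- Without `(p, t)`, the side of `t` is `q + 1, …, t`; the bound `t + 1` admits it.
  · refine Or.inl ⟨(q + 1, t + 1), le_rfl, by dsimp only [ArcExt]; omega, fun h => absurd rfl h,
      fun y hy _ => ?_, fun y hy _ => ?_, fun y hy _ => ?_⟩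
    · have := aA y hy; dsimp only [ArcVanish]; omega
    · have := aB y hy; dsimp only [ArcVanish]; omega
    · have := aC y hy; dsimp only [ArcVanish]; omega
  · have hae := aA e he
    rcases ihA e he with ⟨z, h1, h2, h3⟩ | ⟨z, h1, h2, h3, h4, h5⟩
    · dsimp only [ArcExt] at h2
      by_cases hz : z.2 ≤ p
      · refine Or.inl ⟨z, by omega, h2, fun h => ?_, h3, fun y hy _ => ?_, fun y hy _ => ?_⟩
        · dsimp only [ArcVanish]; omega
        · have := aB y hy; dsimp only [ArcVanish]; omega
        · have := aC y hy; dsimp only [ArcVanish]; omega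
      -- The interval contains `p`, so in the joined set it extends over all of `B` and `C` up to
      -- `t`.
      · refine Or.inl ⟨(z.1, t + 1), by omega, by dsimp only [ArcExt]; omega, fun h => ?_,
          fun y hy hne => ?_, fun y hy _ => ?_, fun y hy _ => ?_⟩
        · dsimp only [ArcVanish]; omega
        · have h6 := aA y hy
          have h7 := h3 y hy hne
          dsimp only [ArcVanish] at h7 ⊢; omega
        · have := aB y hy; dsimp only [ArcVanish]; omega
        · have := aC y hy; dsimp only [ArcVanish]; omega
    · refine Or.inr ⟨z, h1, h2, h3, h4, fun h => ?_, h5, fun y hy _ => ?_, fun y hy _ => ?_⟩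
      · dsimp only [ArcVanish]; omega
      · have := aB y hy; dsimp only [ArcVanish]; omega
      · have := aC y hy; dsimp only [ArcVanish]; omega
  · have hae := aB e he
    rcases ihB e he with ⟨z, h1, h2, h3⟩ | ⟨z, h1, h2, h3, h4, h5⟩
    · dsimp only [ArcExt] at h2
      refine Or.inl ⟨z, by omega, h2, fun h => ?_, fun y hy _ => ?_, h3, fun y hy _ => ?_⟩
      · dsimp only [ArcVanish]; omega
      · have := aA y hy; dsimp only [ArcVanish]; omega
      · have := aC y hy; dsimp only [ArcVanish]; omega
    · refine Or.inr ⟨z, by omega, h2, h3, h4, fun h => ?_, fun y hy _ => ?_, h5, fun y hy _ => ?_⟩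
      · dsimp only [ArcVanish]; omega
      · have := aA y hy; dsimp only [ArcVanish]; omega
      · have := aC y hy; dsimp only [ArcVanish]; omega
  · have hae := aC e he
    rcases ihC e he with ⟨z, h1, h2, h3⟩ | ⟨z, h1, h2, h3, h4, h5⟩
    · dsimp only [ArcExt] at h2
      by_cases hz : z.2 ≤ t
      · refine Or.inl ⟨z, by omega, h2, fun h => ?_, fun y hy _ => ?_, fun y hy _ => ?_, h3⟩
        · dsimp only [ArcVanish]; omega
        · have := aA y hy; dsimp only [ArcVanish]; omega
        · have := aB y hy; dsimp only [ArcVanish]; omega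
      -- The interval contains `t`, which is now tied to `p` and through `A` to `s`. The side
      -- without `s` is what remains of `C`, and it contains the left end of `e`.
      · refine Or.inr ⟨(q + 1, z.1), by omega, by omega, by omega, by omega, fun h => ?_,
          fun y hy _ => ?_, fun y hy _ => ?_, fun y hy hne => ?_⟩
        · dsimp only [ArcVanish]; omega
        · have := aA y hy; dsimp only [ArcVanish]; omega
        · have := aB y hy; dsimp only [ArcVanish]; omega
        · have h6 := aC y hy
          have h7 := h3 y hy hne
          dsimp only [ArcVanish] at h7 ⊢; omega
    · refine Or.inr ⟨z, by omega, h2, h3, h4, fun h => ?_, fun y hy _ => ?_, fun y hy _ => ?_, h5⟩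
      · dsimp only [ArcVanish]; omega
      · have := aA y hy; dsimp only [ArcVanish]; omega
      · have := aB y hy; dsimp only [ArcVanish]; omega

/-- The union of two such witnesses would be closed under all arcs, `e` included, and would contain
`e.1` but not `s`, against connectedness. -/
lemma Complete.nonProj_iff_not_cononProj {s t : ℕ} {S : Finset (ℕ × ℕ)} (h : Complete s t S)
    {e : ℕ × ℕ} (he : e ∈ S) : NonProj (t + 1) S e ↔ ¬ CononProj s S e := by
  refine ⟨?_, (h.nonProj_or_cononProj e he).resolve_right⟩
  rintro ⟨z, h1, h2, h3⟩ ⟨z', h4, h5, h6, h7, h8⟩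
  dsimp only [ArcExt] at h2
  have hae := h.arc e he
  have := h.connected (fun v => (z.1 ≤ v ∧ v < z.2) ∨ (z'.1 ≤ v ∧ v < z'.2)) (fun y hy => ?_)
    e.1 hae.1 (by omega)
  · omega
  · by_cases hne : y = e
    · subst hne; omega
    · have h9 := h3 y hy hne
      have h10 := h8 y hy hne
      dsimp only [ArcVanish] at h9 h10 ⊢
      omega

/-! ### Reflection and translation -/

/-- The reflection `v ↦ q - v` on arcs. -/
def flipArc (q : ℕ) (x : ℕ × ℕ) : ℕ × ℕ := (q - x.2, q - x.1)

/-- The translation by `r` on arcs. -/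
def shiftArc (r : ℕ) (x : ℕ × ℕ) : ℕ × ℕ := (x.1 + r, x.2 + r)

lemma flipArc_flipArc {q : ℕ} {x : ℕ × ℕ} (h1 : x.1 ≤ q) (h2 : x.2 ≤ q) :
    flipArc q (flipArc q x) = x := by
  ext <;> simp only [flipArc] <;> omega

lemma shiftArc_injective (r : ℕ) : Function.Injective (shiftArc r) := fun x y h => by
  have h1 := congrArg Prod.fst h
  have h2 := congrArg Prod.snd h
  simp only [shiftArc] at h1 h2
  ext <;> omega

lemma image_flipArc_image_flipArc {q : ℕ} {S : Finset (ℕ × ℕ)}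
    (h : ∀ x ∈ S, x.1 ≤ q ∧ x.2 ≤ q) : (S.image (flipArc q)).image (flipArc q) = S := by
  rw [Finset.image_image]
  conv_rhs => rw [← Finset.image_id (s := S)]
  exact Finset.image_congr fun x hx => flipArc_flipArc (h x hx).1 (h x hx).2

/-- Reflection is the combinatorial form of vector space duality: it interchanges the arguments of
`ArcVanish`, whence the sign that reverses the order. -/
lemma OrderedBy.flip {q : ℕ} {S : Finset (ℕ × ℕ)} {ρ : ℕ × ℕ → ℤ} (h : OrderedBy S ρ)
    (hS : ∀ x ∈ S, x.1 < x.2 ∧ x.2 ≤ q) :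
    OrderedBy (S.image (flipArc q)) fun x => - ρ (flipArc q x) := by
  have hff : ∀ x ∈ S, flipArc q (flipArc q x) = x := fun x hx => by
    have := hS x hx
    exact flipArc_flipArc (by omega) (by omega)
  refine ⟨?_, ?_⟩
  · intro x hx x' hx' he
    obtain ⟨y, hy, rfl⟩ := Finset.mem_image.1 (Finset.mem_coe.1 hx)
    obtain ⟨y', hy', rfl⟩ := Finset.mem_image.1 (Finset.mem_coe.1 hx')
    dsimp only at he
    rw [hff y hy, hff y' hy', neg_inj] at he
    rw [h.1 hy hy' he]
  · intro x hx x' hx' he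
    obtain ⟨y, hy, rfl⟩ := Finset.mem_image.1 hx
    obtain ⟨y', hy', rfl⟩ := Finset.mem_image.1 hx'
    dsimp only at he
    rw [hff y hy, hff y' hy', neg_lt_neg_iff] at he
    have h3 := h.2 y' hy' y hy he
    have := hS y hy
    have := hS y' hy'
    dsimp only [ArcVanish, flipArc] at h3 ⊢
    omega

lemma Complete.flip {s t q : ℕ} {S : Finset (ℕ × ℕ)} (h : Complete s t S) (hq : t ≤ q) :
    Complete (q - t) (q - s) (S.image (flipArc q)) := by
  have hle := h.le
  obtain ⟨ρ, hρ⟩ := h.ordered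
  refine ⟨⟨by omega, ?_, _, hρ.flip fun x hx => ?_⟩, ?_⟩
  · intro x hx
    obtain ⟨y, hy, rfl⟩ := Finset.mem_image.1 hx
    have := h.arc y hy
    dsimp only [flipArc]; omega
  · have := h.arc x hx
    omega
  · rw [Finset.card_image_of_injOn fun x hx y hy he => by
      have hx' := h.arc x hx
      have hy' := h.arc y hy
      rw [← flipArc_flipArc (q := q) (x := x) (by omega) (by omega), he,
        flipArc_flipArc (by omega) (by omega)], h.card]
    omega

lemma Complete.shift {s t : ℕ} {S : Finset (ℕ × ℕ)} (h : Complete s t S) (r : ℕ) :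
    Complete (s + r) (t + r) (S.image (shiftArc r)) := by
  have hle := h.le
  obtain ⟨ρ, h1, h2⟩ := h.ordered
  have hff : ∀ x, ((shiftArc r x).1 - r, (shiftArc r x).2 - r) = x := fun x => by
    ext <;> simp [shiftArc]
  refine ⟨⟨by omega, ?_, fun x => ρ (x.1 - r, x.2 - r), ?_, ?_⟩, ?_⟩
  · intro x hx
    obtain ⟨y, hy, rfl⟩ := Finset.mem_image.1 hx
    have := h.arc y hy
    dsimp only [shiftArc]; omega
  · intro x hx x' hx' he
    obtain ⟨y, hy, rfl⟩ := Finset.mem_image.1 (Finset.mem_coe.1 hx)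
    obtain ⟨y', hy', rfl⟩ := Finset.mem_image.1 (Finset.mem_coe.1 hx')
    dsimp only at he
    rw [hff y, hff y'] at he
    rw [h1 hy hy' he]
  · intro x hx x' hx' he
    obtain ⟨y, hy, rfl⟩ := Finset.mem_image.1 hx
    obtain ⟨y', hy', rfl⟩ := Finset.mem_image.1 hx'
    dsimp only at he
    rw [hff y, hff y'] at he
    have h3 := h2 y hy y' hy' he
    dsimp only [ArcVanish, shiftArc] at h3 ⊢
    omega
  · rw [Finset.card_image_of_injective _ (shiftArc_injective r), h.card]
    omega

lemma Complete.exists_shift {r t : ℕ} {S : Finset (ℕ × ℕ)} (h : Complete r t S) :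
    ∃ T, Complete 0 (t - r) T ∧ S = T.image (shiftArc r) := by
  have hle := h.le
  -- Two reflections compose to the translation by `-r`.
  have hS : (((S.image (flipArc t)).image (flipArc (t - r))).image (shiftArc r)) = S := by
    rw [Finset.image_image, Finset.image_image]
    conv_rhs => rw [← Finset.image_id (s := S)]
    refine Finset.image_congr fun x hx => ?_
    have := h.arc x hx
    ext <;> simp only [Function.comp, shiftArc, flipArc, id] <;> omega
  refine ⟨_, ?_, hS.symm⟩
  have h1 := (h.flip le_rfl).flip (q := t - r) le_rfl
  rwa [Nat.sub_self, Nat.sub_self, Nat.sub_zero] at h1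

lemma nonProj_shift {r t : ℕ} {S : Finset (ℕ × ℕ)} {e : ℕ × ℕ} :
    NonProj (t + r) (S.image (shiftArc r)) (shiftArc r e) ↔ NonProj t S e := by
  simp only [NonProj, Finset.forall_mem_image, (shiftArc_injective r).ne_iff]
  constructor
  · rintro ⟨z, h1, h2, h3⟩
    dsimp only [ArcExt, shiftArc] at h2
    refine ⟨(z.1 - r, z.2 - r), by omega, by dsimp only [ArcExt]; omega, fun y hy hne => ?_⟩
    have h4 := h3 hy hne
    dsimp only [ArcVanish, shiftArc] at h4 ⊢
    omega
  · rintro ⟨z, h1, h2, h3⟩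
    dsimp only [ArcExt] at h2
    refine ⟨shiftArc r z, by dsimp only [shiftArc]; omega,
      by dsimp only [ArcExt, shiftArc]; omega, fun y hy hne => ?_⟩
    have h4 := h3 y hy hne
    dsimp only [ArcVanish, shiftArc] at h4 ⊢
    omega

lemma nonProj_flip {s t q : ℕ} {S : Finset (ℕ × ℕ)} (hS : ∀ x ∈ S, s ≤ x.1 ∧ x.1 < x.2 ∧ x.2 ≤ t)
    (hq : t ≤ q) {e : ℕ × ℕ} (he : e ∈ S) :
    NonProj (q - s) (S.image (flipArc q)) (flipArc q e) ↔ CononProj s S e := by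
  have hae := hS e he
  have hne : ∀ y ∈ S, (flipArc q y ≠ flipArc q e ↔ y ≠ e) := fun y hy => by
    have hay := hS y hy
    refine not_congr ⟨fun h => ?_, fun h => by rw [h]⟩
    rw [← flipArc_flipArc (q := q) (x := y) (by omega) (by omega), h,
      flipArc_flipArc (by omega) (by omega)]
  simp only [NonProj, CononProj, Finset.forall_mem_image]
  constructor
  · rintro ⟨z, h1, h2, h3⟩
    dsimp only [ArcExt, flipArc] at h2
    -- A witness stands for the points `v` with `z.1 ≤ v < z.2`. The map `v ↦ q - v` turns this
    -- half-open interval around, which accounts for the `+ 1`.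
    refine ⟨(q + 1 - z.2, q + 1 - z.1), by omega, by omega, by omega, by omega,
      fun y hy hy' => ?_⟩
    have h4 := h3 hy ((hne y hy).2 hy')
    have := hS y hy
    dsimp only [ArcVanish, flipArc] at h4 ⊢
    omega
  · rintro ⟨z, h1, h2, h3, h4, h5⟩
    refine ⟨(q + 1 - z.2, q + 1 - z.1), by omega, by dsimp only [ArcExt, flipArc]; omega,
      fun y hy hy' => ?_⟩
    have h6 := h5 y hy ((hne y hy).1 hy')
    have := hS y hy
    dsimp only [ArcVanish, flipArc] at h6 ⊢
    omega

/-! ### Ternary trees -/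

/-- Ternary trees. -/
inductive TernaryTree : Type
  | nil : TernaryTree
  | node (A B C : TernaryTree) : TernaryTree

namespace TernaryTree

/-- The number of nodes. -/
def size : TernaryTree → ℕ
  | nil => 0
  | node A B C => A.size + B.size + C.size + 1

mutual

/-- The number of nodes under an even number of middle edges. -/
def proj : TernaryTree → ℕ
  | nil => 0
  | node A B C => A.proj + B.nonproj + C.proj + 1

/-- The number of nodes under an odd number of middle edges. -/
def nonproj : TernaryTree → ℕ
  | nil => 0
  | node A B C => A.nonproj + B.proj + C.nonproj

end

/-- The complete exceptional set of arcs encoded by a ternary tree. -/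
def arcs : TernaryTree → Finset (ℕ × ℕ)
  | nil => ∅
  | node A B C => joinArcs A.size (A.size + B.size + C.size + 1) A.arcs
      (B.arcs.image (flipArc (A.size + B.size))) (C.arcs.image (shiftArc (A.size + B.size + 1)))

lemma proj_add_nonproj (T : TernaryTree) : T.proj + T.nonproj = T.size := by
  induction T with
  | nil => rfl
  | node A B C hA hB hC => simp only [proj, nonproj, size]; omega

lemma complete_flip_of_zero {q m : ℕ} {S : Finset (ℕ × ℕ)} (h : Complete 0 m S) :
    Complete q (q + m) (S.image (flipArc (q + m))) := by
  have := h.flip (q := q + m) (by omega)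
  rwa [Nat.add_sub_cancel, Nat.sub_zero] at this

lemma complete_shift_of_zero {q m : ℕ} {S : Finset (ℕ × ℕ)} (h : Complete 0 m S) :
    Complete (q + 1) (q + m + 1) (S.image (shiftArc (q + 1))) := by
  have := h.shift (q + 1)
  rwa [Nat.zero_add, show m + (q + 1) = q + m + 1 by omega] at this

lemma complete_arcs (T : TernaryTree) : Complete 0 T.size T.arcs := by
  induction T with
  | nil => exact complete_empty 0
  | node A B C hA hB hC =>
    change Complete 0 (A.size + B.size + C.size + 1) _
    exact Complete.join (q := A.size + B.size) (Nat.zero_le _) (by omega) (by omega) hA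
      (complete_flip_of_zero hB) (complete_shift_of_zero hC)

lemma image_flipArc_injective {q m : ℕ} {S S' : Finset (ℕ × ℕ)} (h : Complete 0 m S)
    (h' : Complete 0 m S') (hm : m ≤ q) (e : S.image (flipArc q) = S'.image (flipArc q)) :
    S = S' := by
  rw [← image_flipArc_image_flipArc (q := q) (S := S) fun x hx => by
    have := h.arc x hx; omega, e, image_flipArc_image_flipArc fun x hx => by
    have := h'.arc x hx; omega]

lemma arcs_injective {T T' : TernaryTree} (hs : T.size = T'.size) (h : T.arcs = T'.arcs) :
    T = T' := by
  induction T generalizing T' with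
  | nil =>
    cases T' with
    | nil => rfl
    | node A B C => simp [size] at hs
  | node A B C hA hB hC =>
    cases T' with
    | nil => simp [size] at hs
    | node A' B' C' =>
      simp only [size, arcs] at hs h
      rw [← hs] at h
      have cC' := complete_shift_of_zero (q := A'.size + B'.size) C'.complete_arcs
      rw [← hs] at cC'
      obtain ⟨h1, h2, h3, h4, h5⟩ := joinArcs_injective (q := A.size + B.size)
        (q' := A'.size + B'.size) (by omega) (by omega) (by omega) (by omega) A.complete_arcs
        (complete_flip_of_zero B.complete_arcs) (complete_shift_of_zero C.complete_arcs)
        A'.complete_arcs (complete_flip_of_zero B'.complete_arcs) cC' h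
      have hB' : B.size = B'.size := by omega
      obtain rfl := hA h1 h3
      rw [← hB'] at h4 h5
      obtain rfl := hB hB' (image_flipArc_injective B.complete_arcs
        (hB' ▸ B'.complete_arcs) (by omega) h4)
      obtain rfl := hC (by omega) (Finset.image_injective (shiftArc_injective _) h5)
      rfl

lemma exists_arcs_eq {n : ℕ} {S : Finset (ℕ × ℕ)} (h : Complete 0 n S) :
    ∃ T : TernaryTree, T.size = n ∧ T.arcs = S := by
  induction n using Nat.strong_induction_on generalizing S with
  | _ n ih =>
    rcases n.eq_zero_or_pos with rfl | hn
    · exact ⟨nil, rfl, h.eq_empty.symm⟩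
    · obtain ⟨p, q, A, B, C, -, hpq, hqt, hA, hB, hC, rfl⟩ := h.exists_split hn
      obtain ⟨C', hC', rfl⟩ := hC.exists_shift
      have hB' := hB.flip (q := q) le_rfl
      rw [Nat.sub_self] at hB'
      obtain ⟨TA, rfl, rfl⟩ := ih p (by omega) hA
      obtain ⟨TB, hTB, hTB'⟩ := ih _ (by omega) hB'
      obtain ⟨TC, hTC, rfl⟩ := ih _ (by omega) hC'
      refine ⟨node TA TB TC, by simp only [size]; omega, ?_⟩
      simp only [arcs]
      rw [hTB', show TA.size + TB.size + TC.size + 1 = n by omega,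
        show TA.size + TB.size = q by omega, image_flipArc_image_flipArc fun x hx => by
          have := hB.arc x hx; omega]

-- The root arc is relatively projective, and `A` and `C` keep their statuses. In the reflected `B`
-- every status is the opposite of that in `B.arcs`, so `B` contributes `B.proj`.
open Classical in
lemma sum_nonProj (T : TernaryTree) :
    ∑ e ∈ T.arcs, (if NonProj T.size T.arcs e then 1 else 0) = T.nonproj := by
  induction T with
  | nil => rfl
  | node A B C hA hB hC =>
    have cA := A.complete_arcs
    have cB := complete_flip_of_zero (q := A.size) B.complete_arcs
    have cC := complete_shift_of_zero (q := A.size + B.size) C.complete_arcs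
    have hpq : A.size ≤ A.size + B.size := by omega
    have hqt : A.size + B.size < A.size + B.size + C.size + 1 := by omega
    change ∑ e ∈ joinArcs A.size (A.size + B.size + C.size + 1) A.arcs
        (B.arcs.image (flipArc (A.size + B.size))) (C.arcs.image (shiftArc (A.size + B.size + 1))),
      (if NonProj (A.size + B.size + C.size + 1) (joinArcs A.size
        (A.size + B.size + C.size + 1) A.arcs (B.arcs.image (flipArc (A.size + B.size)))
        (C.arcs.image (shiftArc (A.size + B.size + 1)))) e then 1 else 0) =
      A.nonproj + B.proj + C.nonproj
    rw [sum_joinArcs hpq hqt cA.toAdmissible cB.toAdmissible cC.toAdmissible,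
      if_neg nonProj_join_self, zero_add]
    have eA : ∀ e ∈ A.arcs, (if NonProj (A.size + B.size + C.size + 1) (joinArcs A.size
        (A.size + B.size + C.size + 1) A.arcs (B.arcs.image (flipArc (A.size + B.size)))
        (C.arcs.image (shiftArc (A.size + B.size + 1)))) e then 1 else 0) =
        if NonProj A.size A.arcs e then 1 else 0 := fun e he => by
      rw [nonProj_join_left hpq hqt cA.toAdmissible cB.toAdmissible cC.toAdmissible he]
    have eC : ∀ e ∈ C.arcs, (if NonProj (A.size + B.size + C.size + 1) (joinArcs A.size
        (A.size + B.size + C.size + 1) A.arcs (B.arcs.image (flipArc (A.size + B.size)))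
        (C.arcs.image (shiftArc (A.size + B.size + 1)))) (shiftArc (A.size + B.size + 1) e)
        then 1 else 0) = if NonProj C.size C.arcs e then 1 else 0 := fun e he => by
      rw [nonProj_join_right hpq cA.toAdmissible cB.toAdmissible cC.toAdmissible
        (Finset.mem_image_of_mem _ he),
        show A.size + B.size + C.size + 1 = C.size + (A.size + B.size + 1) by omega, nonProj_shift]
    have eB : ∀ e ∈ B.arcs, (if NonProj (A.size + B.size + C.size + 1) (joinArcs A.size
        (A.size + B.size + C.size + 1) A.arcs (B.arcs.image (flipArc (A.size + B.size)))
        (C.arcs.image (shiftArc (A.size + B.size + 1)))) (flipArc (A.size + B.size) e)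
        then 1 else 0) + (if NonProj B.size B.arcs e then 1 else 0) = 1 := fun e he => by
      have hm : flipArc (A.size + B.size) e ∈ B.arcs.image (flipArc (A.size + B.size)) :=
        Finset.mem_image_of_mem _ he
      have hb := B.complete_arcs.arc
      have hbe := hb e he
      have h1 := nonProj_flip cB.arc le_rfl hm
      rw [image_flipArc_image_flipArc fun x hx => by have := hb x hx; omega,
        flipArc_flipArc (by omega) (by omega), Nat.add_sub_cancel_left] at h1
      rw [nonProj_join_middle hqt cA.toAdmissible cB.toAdmissible cC.toAdmissible hm,
        cB.nonProj_iff_not_cononProj hm, ← h1]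
      by_cases h : NonProj B.size B.arcs e <;> simp [h]
    have sB := Finset.sum_congr rfl eB
    rw [Finset.sum_add_distrib, hB, ← Finset.card_eq_sum_ones, B.complete_arcs.card,
      Nat.sub_zero] at sB
    replace sB := sB.trans B.proj_add_nonproj.symm
    rw [Finset.sum_congr rfl eA, Finset.sum_image fun x hx y hy h => by
      have hx' := B.complete_arcs.arc x hx
      have hy' := B.complete_arcs.arc y hy
      rw [← flipArc_flipArc (q := A.size + B.size) (x := x) (by omega) (by omega), h,
        flipArc_flipArc (by omega) (by omega)],
      Finset.sum_image (shiftArc_injective _).injOn, Finset.sum_congr rfl eC, hA, hC]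
    exact congrArg (fun x => A.nonproj + x + C.nonproj) (Nat.add_right_cancel sB)

lemma arcs_subset (T : TernaryTree) :
    T.arcs ⊆ Finset.range (T.size + 1) ×ˢ Finset.range (T.size + 1) := fun x hx => by
  have := T.complete_arcs.arc x hx
  rw [Finset.mem_product, Finset.mem_range, Finset.mem_range]
  omega

lemma finite_size (n : ℕ) : {T : TernaryTree | T.size = n}.Finite := by
  refine Set.Finite.of_finite_image (f := arcs) (Set.Finite.subset
    (Finset.finite_toSet (Finset.range (n + 1) ×ˢ Finset.range (n + 1)).powerset) ?_) ?_
  · rintro _ ⟨T, rfl, rfl⟩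
    exact Finset.mem_coe.2 (Finset.mem_powerset.2 T.arcs_subset)
  · intro T hT T' hT' h
    exact arcs_injective (hT.trans hT'.symm) h

lemma finite_proj (n m : ℕ) : {T : TernaryTree | T.proj = n ∧ T.nonproj = m}.Finite :=
  (finite_size (n + m)).subset fun T hT => by
    rw [Set.mem_ofPred_eq, ← proj_add_nonproj, hT.1, hT.2]

/-- The number of ternary trees with given statistics. -/
noncomputable def count (n m : ℕ) : ℕ := (finite_proj n m).toFinset.card

/-- A nonempty tree is the triple of its subtrees. Their statistics recover the two summation
indices, those of the middle subtree being exchanged. -/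
theorem satisfiesRecursion_count : SatisfiesRecursion count := by
  have h0 : ∀ T : TernaryTree, T.proj = 0 → T = nil := fun T hT => by
    cases T with
    | nil => rfl
    | node A B C => simp [proj] at hT
  refine ⟨?_, fun k hk => ?_, fun n m hn => ?_⟩
  · refine Finset.card_eq_one.2 ⟨nil, ?_⟩
    ext T
    simp only [Set.Finite.mem_toFinset, Set.mem_ofPred_eq, Finset.mem_singleton]
    exact ⟨fun h => h0 T h.1, by rintro rfl; exact ⟨rfl, rfl⟩⟩
  · refine Finset.card_eq_zero.2 (Finset.eq_empty_of_forall_notMem fun T hT => ?_)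
    simp only [Set.Finite.mem_toFinset, Set.mem_ofPred_eq] at hT
    rw [h0 T hT.1] at hT
    exact hk.ne hT.2
  · rw [← Finset.sum_product']
    simp only [count, ← Finset.card_product]
    rw [← Finset.card_sigma]
    symm
    refine Finset.card_bij (fun x _ => node x.2.1.1 x.2.1.2 x.2.2) ?_ ?_ ?_
    · rintro ⟨⟨p, q⟩, ⟨⟨A, B⟩, C⟩⟩ h
      simp only [Finset.mem_sigma, Finset.mem_product, Finset.Nat.mem_antidiagonalTuple,
        Set.Finite.mem_toFinset, Set.mem_ofPred_eq, Fin.sum_univ_three] at h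
      simp only [Set.Finite.mem_toFinset, Set.mem_ofPred_eq, proj, nonproj]
      omega
    · rintro ⟨⟨p, q⟩, ⟨⟨A, B⟩, C⟩⟩ h ⟨⟨p', q'⟩, ⟨⟨A', B'⟩, C'⟩⟩ h' he
      simp only [Finset.mem_sigma, Finset.mem_product, Set.Finite.mem_toFinset,
        Set.mem_ofPred_eq] at h h'
      simp only [node.injEq] at he
      obtain ⟨rfl, rfl, rfl⟩ := he
      obtain rfl : p = p' := by
        funext i; fin_cases i <;> simp only [Fin.mk_zero', Fin.mk_one, Fin.reduceFinMk] <;> omega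
      obtain rfl : q = q' := by
        funext i; fin_cases i <;> simp only [Fin.mk_zero', Fin.mk_one, Fin.reduceFinMk] <;> omega
      rfl
    · intro T hT
      simp only [Set.Finite.mem_toFinset, Set.mem_ofPred_eq] at hT
      cases T with
      | nil => simp only [proj] at hT; omega
      | node A B C =>
        simp only [proj, nonproj] at hT
        refine ⟨⟨(![A.proj, B.nonproj, C.proj], ![A.nonproj, B.proj, C.nonproj]), ((A, B), C)⟩,
          ?_, rfl⟩
        simp [Finset.Nat.mem_antidiagonalTuple, Fin.sum_univ_three]
        omega

end TernaryTree

open Classical in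
theorem ncard_complete (n m : ℕ) :
    {S : Finset (ℕ × ℕ) | Complete 0 (n + m) S ∧
      (S.filter fun e => ¬ NonProj (n + m) S e).card = n}.ncard = TernaryTree.count n m := by
  have key : ∀ T : TernaryTree, T.size = n + m →
      ((T.arcs.filter fun e => ¬ NonProj (n + m) T.arcs e).card = n ↔ T.proj = n) := by
    intro T hT
    have h1 := T.sum_nonProj
    rw [← Finset.card_filter, hT] at h1
    have h2 := Finset.card_filter_add_card_filter_not (s := T.arcs)
      (fun e => NonProj (n + m) T.arcs e)
    rw [T.complete_arcs.card, ← T.proj_add_nonproj] at h2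
    omega
  rw [TernaryTree.count, ← Set.ncard_coe_finset, ← Set.InjOn.ncard_image (f := TernaryTree.arcs)]
  · congr 1
    ext S
    simp only [Set.mem_ofPred_eq, Set.Finite.coe_toFinset, Set.mem_image]
    constructor
    · rintro ⟨hS, hc⟩
      obtain ⟨T, hT, rfl⟩ := TernaryTree.exists_arcs_eq hS
      have h1 := (key T hT).1 hc
      have h2 := T.proj_add_nonproj
      exact ⟨T, ⟨h1, by omega⟩, rfl⟩
    · rintro ⟨T, ⟨h1, h2⟩, rfl⟩
      have hT : T.size = n + m := by rw [← T.proj_add_nonproj, h1, h2]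
      exact ⟨hT ▸ T.complete_arcs, (key T hT).2 h1⟩
  · intro T hT T' hT' h
    simp only [Set.Finite.coe_toFinset, Set.mem_ofPred_eq] at hT hT'
    refine TernaryTree.arcs_injective ?_ h
    rw [← T.proj_add_nonproj, ← T'.proj_add_nonproj, hT.1, hT.2, hT'.1, hT'.2]

/-! ### The functional equation -/

/-- The exponent of the monomial `xⁿ yᵐ`. -/
noncomputable def expo (n m : ℕ) : Fin 2 →₀ ℕ := Finsupp.equivFunOnFinite.symm ![n, m]

@[simp] lemma expo_zero (n m : ℕ) : expo n m 0 = n := rfl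

@[simp] lemma expo_one (n m : ℕ) : expo n m 1 = m := rfl

lemma expo_eta (d : Fin 2 →₀ ℕ) : expo (d 0) (d 1) = d := by
  ext i; fin_cases i <;> rfl

lemma coeff_twoVarGenFun (N : ℕ → ℕ → ℕ) (n m : ℕ) :
    MvPowerSeries.coeff (expo n m) (twoVarGenFun N) = N n m := rfl

lemma coeff_expo_mul (n m : ℕ) (f g : MvPowerSeries (Fin 2) ℤ) :
    MvPowerSeries.coeff (expo n m) (f * g) =
      ∑ p ∈ Finset.HasAntidiagonal.antidiagonal n, ∑ q ∈ Finset.HasAntidiagonal.antidiagonal m,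
        MvPowerSeries.coeff (expo p.1 q.1) f * MvPowerSeries.coeff (expo p.2 q.2) g := by
  classical
  rw [MvPowerSeries.coeff_mul, ← Finset.sum_product']
  refine Finset.sum_nbij' (fun d => ((d.1 0, d.2 0), (d.1 1, d.2 1)))
    (fun x => (expo x.1.1 x.2.1, expo x.1.2 x.2.2)) ?_ ?_ ?_ ?_ ?_
  · intro d hd
    rw [Finset.HasAntidiagonal.mem_antidiagonal] at hd
    have h0 := DFunLike.congr_fun hd 0
    have h1 := DFunLike.congr_fun hd 1
    simp only [Finset.mem_product, Finset.HasAntidiagonal.mem_antidiagonal]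
    exact ⟨h0, h1⟩
  · intro x hx
    simp only [Finset.mem_product, Finset.HasAntidiagonal.mem_antidiagonal] at hx
    rw [Finset.HasAntidiagonal.mem_antidiagonal]
    ext i; fin_cases i
    · exact hx.1
    · exact hx.2
  · intro d _
    simp only [expo_eta]
  · intro x _
    rfl
  · intro d _
    simp only [expo_eta]

lemma coeff_rename_swap (N : ℕ → ℕ → ℕ) (n m : ℕ) :
    MvPowerSeries.coeff (expo n m)
      (MvPowerSeries.rename (Equiv.swap (0 : Fin 2) 1) (twoVarGenFun N)) = N m n := by
  have h := MvPowerSeries.coeff_embDomain_rename (Equiv.swap (0 : Fin 2) 1).toEmbedding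
    (twoVarGenFun N) (expo m n)
  have e : Finsupp.embDomain (Equiv.swap (0 : Fin 2) 1).toEmbedding (expo m n) = expo n m := by
    ext i
    fin_cases i
    · exact Finsupp.embDomain_apply_self (Equiv.swap (0 : Fin 2) 1).toEmbedding (expo m n) 1
    · exact Finsupp.embDomain_apply_self (Equiv.swap (0 : Fin 2) 1).toEmbedding (expo m n) 0
  rw [e] at h
  exact h

lemma coeff_expo_X_mul (n m : ℕ) (f : MvPowerSeries (Fin 2) ℤ) :
    MvPowerSeries.coeff (expo (n + 1) m) (MvPowerSeries.X 0 * f) =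
      MvPowerSeries.coeff (expo n m) f := by
  have e : expo (n + 1) m = Finsupp.single 0 1 + expo n m := by
    ext i; fin_cases i
    · simp [add_comm]
    · simp
  rw [e, MvPowerSeries.X, MvPowerSeries.coeff_add_monomial_mul, one_mul]

lemma coeff_expo_zero_X_mul (m : ℕ) (f : MvPowerSeries (Fin 2) ℤ) :
    MvPowerSeries.coeff (expo 0 m) (MvPowerSeries.X 0 * f) = 0 := by
  rw [MvPowerSeries.X, MvPowerSeries.coeff_monomial_mul, if_neg]
  intro h
  have := h 0
  simp at this

/-- The middle entry is split off first: the inner antidiagonal serves the square `f(x, y)²`, the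
second outer component the factor `f(y, x)`. -/
lemma sum_antidiagonalTuple_three {M : Type*} [AddCommMonoid M] (n : ℕ) (F : ℕ → ℕ → ℕ → M) :
    ∑ p ∈ Finset.Nat.antidiagonalTuple 3 n, F (p 0) (p 1) (p 2) =
      ∑ p ∈ Finset.HasAntidiagonal.antidiagonal n, ∑ p' ∈ Finset.HasAntidiagonal.antidiagonal p.1, F p'.1 p.2 p'.2 := by
  rw [Finset.sum_sigma']
  refine Finset.sum_nbij' (fun p => ⟨(p 0 + p 2, p 1), (p 0, p 2)⟩)
    (fun x => ![x.2.1, x.1.2, x.2.2]) ?_ ?_ ?_ ?_ ?_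
  · intro p hp
    rw [Finset.Nat.mem_antidiagonalTuple, Fin.sum_univ_three] at hp
    refine Finset.mem_sigma.2 ⟨Finset.HasAntidiagonal.mem_antidiagonal.2 ?_,
      Finset.HasAntidiagonal.mem_antidiagonal.2 rfl⟩
    change p 0 + p 2 + p 1 = n
    omega
  · rintro ⟨⟨a, b⟩, ⟨c, d⟩⟩ hx
    simp only [Finset.mem_sigma, Finset.HasAntidiagonal.mem_antidiagonal] at hx
    rw [Finset.Nat.mem_antidiagonalTuple, Fin.sum_univ_three]
    change c + b + d = n
    omega
  · intro p _
    funext i; fin_cases i <;> rfl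
  · rintro ⟨⟨a, b⟩, ⟨c, d⟩⟩ hx
    simp only [Finset.mem_sigma, Finset.HasAntidiagonal.mem_antidiagonal] at hx
    obtain ⟨-, rfl⟩ := hx
    rfl
  · intro p _
    rfl

lemma coeff_triple (N : ℕ → ℕ → ℕ) (n m : ℕ) :
    MvPowerSeries.coeff (expo n m) (twoVarGenFun N ^ 2 *
      MvPowerSeries.rename (Equiv.swap (0 : Fin 2) 1) (twoVarGenFun N)) =
    ((∑ p ∈ Finset.Nat.antidiagonalTuple 3 n, ∑ q ∈ Finset.Nat.antidiagonalTuple 3 m,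
        N (p 0) (q 0) * N (q 1) (p 1) * N (p 2) (q 2) : ℕ) : ℤ) := by
  have h1 := sum_antidiagonalTuple_three n fun a b c =>
    ∑ q ∈ Finset.Nat.antidiagonalTuple 3 m, N a (q 0) * N (q 1) b * N c (q 2)
  have h2 := fun a b c => sum_antidiagonalTuple_three m fun i j k => N a i * N j b * N c k
  simp only [h2] at h1 ⊢
  rw [h1, coeff_expo_mul]
  push_cast
  refine Finset.sum_congr rfl fun p _ => ?_
  rw [Finset.sum_comm]
  refine Finset.sum_congr rfl fun q _ => ?_
  rw [pow_two, coeff_expo_mul, coeff_rename_swap, Finset.sum_mul]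
  refine Finset.sum_congr rfl fun p' _ => ?_
  rw [Finset.sum_mul]
  refine Finset.sum_congr rfl fun q' _ => ?_
  rw [coeff_twoVarGenFun, coeff_twoVarGenFun]
  ring

theorem satisfiesRecursion_iff (N : ℕ → ℕ → ℕ) :
    SatisfiesRecursion N ↔ SatisfiesFunctionalEquation N := by
  classical
  have hone : ∀ n m, MvPowerSeries.coeff (expo n m) (1 : MvPowerSeries (Fin 2) ℤ) =
      if n = 0 ∧ m = 0 then 1 else 0 := fun n m => by
    rw [MvPowerSeries.coeff_one]
    refine if_congr ⟨fun h => ?_, fun h => ?_⟩ rfl rfl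
    · exact ⟨DFunLike.congr_fun h 0, DFunLike.congr_fun h 1⟩
    · ext i; fin_cases i
      exacts [h.1, h.2]
  have hcoeff : SatisfiesFunctionalEquation N ↔ ∀ n m, (N n m : ℤ) =
      (if n = 0 ∧ m = 0 then 1 else 0) + MvPowerSeries.coeff (expo n m) (MvPowerSeries.X 0 *
        (twoVarGenFun N ^ 2 *
          MvPowerSeries.rename (Equiv.swap (0 : Fin 2) 1) (twoVarGenFun N))) := by
    rw [SatisfiesFunctionalEquation, mul_assoc, MvPowerSeries.ext_iff]
    constructor
    · intro h n m
      rw [← hone, ← map_add]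
      exact h (expo n m)
    · intro h d
      have := h (d 0) (d 1)
      rw [← hone, ← map_add, expo_eta] at this
      exact this
  rw [hcoeff]
  constructor
  · rintro ⟨h1, h2, h3⟩ n m
    rcases n with _ | n
    · rw [coeff_expo_zero_X_mul, add_zero]
      rcases m with _ | m
      · simp [h1]
      · simp [h2 (m + 1) m.succ_pos]
    · rw [coeff_expo_X_mul, coeff_triple, if_neg (by omega), zero_add, h3 (n + 1) m (by omega)]
      rfl
  · intro h
    refine ⟨?_, fun m hm => ?_, fun n m hn => ?_⟩
    · have := h 0 0
      rw [coeff_expo_zero_X_mul] at this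
      simpa using this
    · have := h 0 m
      rw [coeff_expo_zero_X_mul, if_neg (by omega)] at this
      simpa using this
    · obtain ⟨n, rfl⟩ := Nat.exists_eq_add_of_le' hn
      have := h (n + 1) m
      rw [coeff_expo_X_mul, coeff_triple, if_neg (by omega), zero_add] at this
      exact_mod_cast this

/-- For `m = 0` the middle factor is `N 0 b`, which vanishes unless `b = 0`; the Catalan recurrence
remains. -/
theorem eq_catalan {N : ℕ → ℕ → ℕ} (h : SatisfiesRecursion N) (n : ℕ) : N n 0 = catalan n := by
  obtain ⟨h1, h2, h3⟩ := h
  induction n using Nat.strong_induction_on with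
  | _ n ih =>
    rcases n with _ | n
    · rw [h1, catalan_zero]
    · rw [h3 (n + 1) 0 (by omega), catalan_succ', Nat.add_sub_cancel,
        Finset.Nat.antidiagonalTuple_zero_right]
      simp only [Finset.sum_singleton, Pi.zero_apply]
      rw [sum_antidiagonalTuple_three n fun a b c => N a 0 * N 0 b * N c 0,
        Finset.sum_eq_single (n, 0)]
      · refine Finset.sum_congr rfl fun p hp => ?_
        rw [Finset.HasAntidiagonal.mem_antidiagonal] at hp
        rw [h1, mul_one, ih p.1 (by omega), ih p.2 (by omega)]
      · rintro ⟨a, b⟩ hp hne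
        rw [Finset.HasAntidiagonal.mem_antidiagonal] at hp
        have hb : 0 < b := Nat.pos_of_ne_zero fun hb => hne (by
          subst hb; dsimp only at hp; rw [← hp]; rfl)
        simp only [h2 b hb, mul_zero, zero_mul, Finset.sum_const_zero]
      · intro hn
        simp at hn

theorem catalan_eq_div (n : ℕ) :
    (catalan n : ℚ) = 1 / ((n : ℚ) + 1) * ((2 * n).choose n : ℚ) := by
  have h := succ_mul_catalan_eq_centralBinom n
  have hn : (n : ℚ) + 1 ≠ 0 := by positivity
  rw [← Nat.centralBinom_eq_two_mul_choose, ← h]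
  push_cast
  field_simp

/-! ### Exceptional sets and sets of arcs -/

section Sequences

lemma not_arcVanish_self {n : ℕ} {x : ℕ × ℕ} (hx : IsArc n x) : ¬ ArcVanish x x := by
  dsimp only [IsArc, ArcVanish] at *
  omega

variable {n : ℕ} {x : Fin n → ℕ × ℕ} (hx : ∀ i, IsArc n (x i))
  (hv : ∀ i j, j < i → ArcVanish (x i) (x j))
include hx hv

lemma injective_of_arcVanish : Function.Injective x := fun i j h => by
  rcases lt_trichotomy i j with hlt | rfl | hlt
  · exact absurd (h ▸ hv j i hlt) (not_arcVanish_self (hx j))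
  · rfl
  · exact absurd (h ▸ hv i j hlt) (not_arcVanish_self (hx _))

lemma exists_orderedBy : ∃ ρ : ℕ × ℕ → ℤ, (∀ i, ρ (x i) = (i : ℕ)) ∧
    OrderedBy (Finset.univ.image x) ρ := by
  have hinj := injective_of_arcVanish hx hv
  have hρ : ∀ i, Function.extend x (fun i => ((i : ℕ) : ℤ)) (fun _ => 0) (x i) = (i : ℕ) :=
    fun i => hinj.extend_apply _ _ i
  refine ⟨_, hρ, fun y hy y' hy' h => ?_, fun y hy y' hy' h => ?_⟩
  · obtain ⟨i, -, rfl⟩ := Finset.mem_image.1 (Finset.mem_coe.1 hy)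
    obtain ⟨j, -, rfl⟩ := Finset.mem_image.1 (Finset.mem_coe.1 hy')
    rw [hρ, hρ] at h
    rw [Fin.ext (Int.ofNat_inj.1 h)]
  · obtain ⟨i, -, rfl⟩ := Finset.mem_image.1 hy
    obtain ⟨j, -, rfl⟩ := Finset.mem_image.1 hy'
    rw [hρ, hρ] at h
    exact hv i j (Fin.lt_def.2 (Int.ofNat_lt.1 h))

lemma complete_image : Complete 0 n (Finset.univ.image x) := by
  obtain ⟨ρ, -, hρ⟩ := exists_orderedBy hx hv
  refine ⟨⟨Nat.zero_le _, fun y hy => ?_, ρ, hρ⟩, ?_⟩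
  · obtain ⟨i, -, rfl⟩ := Finset.mem_image.1 hy
    exact ⟨Nat.zero_le _, hx i⟩
  · rw [Finset.card_image_of_injective _ (injective_of_arcVanish hx hv), Finset.card_univ,
      Fintype.card_fin, Nat.sub_zero]

end Sequences

lemma Complete.isArc {n : ℕ} {T : Finset (ℕ × ℕ)} (h : Complete 0 n T) {x : ℕ × ℕ} (hx : x ∈ T) :
    IsArc n x := (h.arc x hx).2

lemma Complete.exists_sequence {n : ℕ} {T : Finset (ℕ × ℕ)} (h : Complete 0 n T) :
    ∃ x : Fin n → ℕ × ℕ, (∀ i, IsArc n (x i)) ∧ (∀ i j, j < i → ArcVanish (x i) (x j)) ∧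
      Finset.univ.image x = T := by
  obtain ⟨ρ, h1, h2⟩ := h.ordered
  have hc : (T.image ρ).card = n := by
    rw [Finset.card_image_of_injOn h1, h.card, Nat.sub_zero]
  -- The arcs are listed by increasing weight.
  let o := (T.image ρ).orderEmbOfFin hc
  have ho : ∀ i, ∃ x ∈ T, ρ x = o i := fun i =>
    Finset.mem_image.1 (Finset.orderEmbOfFin_mem _ hc i)
  choose x hxT hxo using ho
  have hx : ∀ i, IsArc n (x i) := fun i => h.isArc (hxT i)
  have hv : ∀ i j, j < i → ArcVanish (x i) (x j) := fun i j hij =>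
    h2 _ (hxT i) _ (hxT j) (by rw [hxo, hxo]; exact o.strictMono hij)
  refine ⟨x, hx, hv, Finset.eq_of_subset_of_card_le ?_ ?_⟩
  · intro y hy
    obtain ⟨i, -, rfl⟩ := Finset.mem_image.1 hy
    exact hxT i
  · rw [(complete_image hx hv).card, h.card]

-- Transfer from sets of arcs to sets of isomorphism classes

namespace LinearRep

variable {k : Type u} [Field k] {n : ℕ}

lemma class_eq_iff {V W : LinearRep k n} : linearRepClass V = linearRepClass W ↔ Nonempty (V ≅ W) :=
  Quotient.eq (r := isIsomorphicSetoid (LinearRep k n))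

variable (k n) in
/-- The isomorphism class of the interval module of an arc. -/
noncomputable def arcClass (x : ℕ × ℕ) : LinearRepClass k n :=
  linearRepClass (interval k n x.1 x.2)

/-- An isomorphism and its inverse are nonzero, and the inequalities for nonzero maps in both
directions determine both ends. -/
lemma arcClass_injOn : Set.InjOn (arcClass k n) {x | IsArc n x} := by
  rintro ⟨a, b⟩ ⟨hab, hb⟩ ⟨c, d⟩ ⟨hcd, hd⟩ h
  obtain ⟨e⟩ := class_eq_iff.1 h
  dsimp only at *
  have h1 : e.hom ≠ 0 := fun h0 => id_interval_ne_zero (k := k) hab hb (by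
    rw [← e.hom_inv_id, h0, zero_comp])
  have h2 : e.inv ≠ 0 := fun h0 => id_interval_ne_zero (k := k) hab hb (by
    rw [← e.hom_inv_id, h0, comp_zero])
  have h3 : c ≤ a ∧ a < d ∧ d ≤ b := by
    by_contra hn
    exact h1 (interval_hom_eq_zero hab (by omega) hd hn _)
  have h4 : a ≤ c ∧ c < b ∧ b ≤ d := by
    by_contra hn
    exact h2 (interval_hom_eq_zero hcd (by omega) hb hn _)
  ext <;> dsimp only <;> omega

variable (k n) in
/-- The set of isomorphism classes given by a set of arcs. -/
def classSet (T : Finset (ℕ × ℕ)) : Set (LinearRepClass k n) := arcClass k n '' T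

lemma classSet_injOn : Set.InjOn (classSet k n) {T | Complete 0 n T} := by
  intro T hT T' hT' h
  exact Finset.coe_injective ((arcClass_injOn.image_eq_image_iff (fun x hx => hT.isArc hx)
    fun x hx => hT'.isArc hx).1 h)

lemma exists_arcs_of_sequence {E : Fin n → LinearRep k n}
    (hE : IsExceptionalSequence.{u + 1} E) : ∃ x : Fin n → ℕ × ℕ, (∀ i, IsArc n (x i)) ∧
      (∀ i, Nonempty (E i ≅ interval k n (x i).1 (x i).2)) ∧
      ∀ i j, j < i → ArcVanish (x i) (x j) := by
  choose x hx e using fun i => exists_iso_interval (hE.exceptional i)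
  exact ⟨x, hx, e, fun i j hij => (vanish_iff_arcVanish (hx i) (hx j) (e i).some (e j).some).1
    (hE.vanish i j hij)⟩

lemma range_class_eq {E : Fin n → LinearRep k n} {x : Fin n → ℕ × ℕ}
    (e : ∀ i, Nonempty (E i ≅ interval k n (x i).1 (x i).2)) :
    Set.range (fun i => linearRepClass (E i)) = classSet k n (Finset.univ.image x) := by
  rw [classSet, Finset.coe_image, Finset.coe_univ, Set.image_univ, ← Set.range_comp]
  exact congrArg Set.range (funext fun i => class_eq_iff.2 (e i))

lemma isExceptionalSequence_interval {x : Fin n → ℕ × ℕ} (hx : ∀ i, IsArc n (x i))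
    (hv : ∀ i j, j < i → ArcVanish (x i) (x j)) :
    IsExceptionalSequence.{u + 1} fun i => interval k n (x i).1 (x i).2 :=
  ⟨fun i => isExceptional_interval (hx i).1 (hx i).2, fun i j hij =>
    (vanish_iff_arcVanish (hx i) (hx j) (Iso.refl _) (Iso.refl _)).2 (hv i j hij)⟩

theorem isExceptionalSet_iff {S : Set (LinearRepClass k n)} :
    IsExceptionalSet S ↔ ∃ T, Complete 0 n T ∧ classSet k n T = S := by
  constructor
  · rintro ⟨E, hE, rfl⟩
    obtain ⟨x, hx, e, hv⟩ := exists_arcs_of_sequence hE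
    exact ⟨_, complete_image hx hv, (range_class_eq e).symm⟩
  · rintro ⟨T, hT, rfl⟩
    obtain ⟨x, hx, hv, rfl⟩ := hT.exists_sequence
    exact ⟨_, isExceptionalSequence_interval hx hv, range_class_eq fun i => ⟨Iso.refl _⟩⟩

theorem finite_isExceptionalSet : {S : Set (LinearRepClass k n) | IsExceptionalSet S}.Finite := by
  refine Set.Finite.subset (Set.Finite.image (classSet k n) (Finset.finite_toSet
    (Finset.range (n + 1) ×ˢ Finset.range (n + 1)).powerset)) fun S hS => ?_
  obtain ⟨T, hT, rfl⟩ := isExceptionalSet_iff.1 hS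
  refine ⟨T, Finset.mem_coe.2 (Finset.mem_powerset.2 fun x hx => ?_), rfl⟩
  have := hT.arc x hx
  rw [Finset.mem_product, Finset.mem_range, Finset.mem_range]
  omega

/-- The relatively distinguished objects of an exceptional set correspond to the arcs with a
property `Q`, if this holds in each ordering. -/
lemma rel_eq_image {T : Finset (ℕ × ℕ)} (hT : Complete 0 n T) {Q : ℕ × ℕ → Prop}
    {R : (Fin n → LinearRep k n) → Fin n → Prop}
    (hR : ∀ (E : Fin n → LinearRep k n) (x : Fin n → ℕ × ℕ), (∀ i, IsArc n (x i)) →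
      (∀ i, Nonempty (E i ≅ interval k n (x i).1 (x i).2)) →
      (∀ i j, j < i → ArcVanish (x i) (x j)) → Finset.univ.image x = T →
      ∀ i, R E i ↔ Q (x i)) :
    {c | ∃ E : Fin n → LinearRep k n, IsOrdering (classSet k n T) E ∧
      ∃ i, linearRepClass (E i) = c ∧ R E i} = arcClass k n '' {e | e ∈ T ∧ Q e} := by
  ext c
  constructor
  · rintro ⟨E, ⟨hE, hr⟩, i, rfl, hi⟩
    obtain ⟨x, hx, e, hv⟩ := exists_arcs_of_sequence hE
    have hxT : Finset.univ.image x = T :=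
      classSet_injOn (k := k) (complete_image hx hv) hT ((range_class_eq e).symm.trans hr)
    exact ⟨x i, ⟨hxT ▸ Finset.mem_image_of_mem _ (Finset.mem_univ i),
      (hR E x hx e hv hxT i).1 hi⟩, (class_eq_iff.2 (e i)).symm⟩
  · rintro ⟨y, ⟨hy, hQ⟩, rfl⟩
    obtain ⟨x, hx, hv, rfl⟩ := hT.exists_sequence
    obtain ⟨i, -, rfl⟩ := Finset.mem_image.1 hy
    have e : ∀ i, Nonempty (interval k n (x i).1 (x i).2 ≅ interval k n (x i).1 (x i).2) :=
      fun i => ⟨Iso.refl _⟩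
    exact ⟨_, ⟨isExceptionalSequence_interval hx hv, range_class_eq e⟩, i, rfl,
      (hR _ x hx e hv rfl i).2 hQ⟩

theorem relProjectives_classSet {T : Finset (ℕ × ℕ)} (hT : Complete 0 n T) :
    relProjectives (classSet k n T) = arcClass k n '' {e | e ∈ T ∧ ¬ NonProj n T e} := by
  refine rel_eq_image hT fun E x hx e hv hxT i => ?_
  obtain ⟨ρ, hρ, ho⟩ := exists_orderedBy hx hv
  rw [hxT] at ho
  have hmem : ∀ j, x j ∈ T := fun j => hxT ▸ Finset.mem_image_of_mem _ (Finset.mem_univ j)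
  refine (isRelProjectiveWrt_iff (J := Set.Ioi i) (fun j => hx j) (fun j => (e j).some) (hx i)
    (e i).some).trans ?_
  rw [and_iff_right fun j : Set.Ioi i => hv j i j.2,
    ← nonProj_iff_of_orderedBy ho (fun y hy => (hT.isArc hy).1) (hmem i)]
  refine not_congr (exists_congr fun z => ?_)
  constructor
  · rintro ⟨h1, h2, h3⟩
    refine ⟨h1.2, h3, fun y hy hlt => ?_⟩
    rw [← hxT] at hy
    obtain ⟨j, -, rfl⟩ := Finset.mem_image.1 hy
    rw [hρ, hρ] at hlt
    exact h2 ⟨j, Fin.lt_def.2 (Int.ofNat_lt.1 hlt)⟩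
  · rintro ⟨h1, h2, h3⟩
    refine ⟨⟨by dsimp only [ArcExt] at h2; omega, h1⟩, fun j => h3 _ (hmem j) ?_, h2⟩
    rw [hρ, hρ]
    exact Int.ofNat_lt.2 j.2

/-- By duality, reflection turns the terms before an arc into terms after it and reverses
extensions, so relative injectivity becomes relative projectivity of the reflected arc. -/
theorem relInjectives_classSet {T : Finset (ℕ × ℕ)} (hT : Complete 0 n T) :
    relInjectives (classSet k n T) =
      arcClass k n '' {e | e ∈ T ∧ ¬ NonProj n (T.image (flipArc n)) (flipArc n e)} := by
  refine rel_eq_image hT fun E x hx e hv hxT i => ?_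
  obtain ⟨ρ, hρ, ho⟩ := exists_orderedBy hx hv
  rw [hxT] at ho
  have hmem : ∀ j, x j ∈ T := fun j => hxT ▸ Finset.mem_image_of_mem _ (Finset.mem_univ j)
  have hff : ∀ y, IsArc n y → flipArc n (flipArc n y) = y := fun y hy => by
    dsimp only [IsArc] at hy
    exact flipArc_flipArc (by omega) (by omega)
  refine (isRelInjectiveWrt_iff (J := Set.Iio i) (fun j => hx j) (fun j => (e j).some) (hx i)
    (e i).some).trans ?_
  rw [and_iff_right fun j : Set.Iio i => hv i j j.2,
    ← nonProj_iff_of_orderedBy (ho.flip fun y hy => hT.isArc hy) ?_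
      (Finset.mem_image_of_mem _ (hmem i))]
  · refine not_congr ?_
    simp only [Finset.forall_mem_image]
    have hi := hx i
    dsimp only [IsArc] at hi
    constructor
    · rintro ⟨z, h1, h2, h3⟩
      dsimp only [IsArc, ArcExt] at h1 h3
      -- Here `z` is reflected as an arc, without a shift by one, because the arguments of
      -- `ArcVanish` are interchanged as well.
      refine ⟨flipArc n z, by dsimp only [flipArc]; omega,
        by dsimp only [ArcExt, flipArc]; omega, fun y hy hlt => ?_⟩
      have hy' := hT.isArc hy
      rw [hff _ (hx i), hff _ hy', neg_lt_neg_iff] at hlt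
      rw [← hxT] at hy
      obtain ⟨j, -, rfl⟩ := Finset.mem_image.1 hy
      rw [hρ, hρ] at hlt
      have h4 := h2 ⟨j, Fin.lt_def.2 (Int.ofNat_lt.1 hlt)⟩
      dsimp only [IsArc] at hy'
      dsimp only [ArcVanish, flipArc] at h4 ⊢
      omega
    · rintro ⟨z, h1, h2, h3⟩
      dsimp only [ArcExt, flipArc] at h2
      refine ⟨flipArc n z, ⟨by dsimp only [flipArc]; omega, by dsimp only [flipArc]; omega⟩,
        fun j => ?_, by dsimp only [ArcExt, flipArc]; omega⟩
      have hj := hx j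
      have h4 := h3 (hmem j) (by
        rw [hff _ (hx i), hff _ hj, neg_lt_neg_iff, hρ, hρ]
        exact Int.ofNat_lt.2 j.2)
      dsimp only [IsArc] at hj
      dsimp only [ArcVanish, flipArc] at h4 ⊢
      omega
  · intro y hy
    obtain ⟨y', hy', rfl⟩ := Finset.mem_image.1 hy
    have := hT.isArc hy'
    dsimp only [IsArc, flipArc] at *
    omega

lemma ncard_isExceptionalSet {rel : Set (LinearRepClass k n) → Set (LinearRepClass k n)}
    {Q : Finset (ℕ × ℕ) → ℕ × ℕ → Prop} [∀ T, DecidablePred (Q T)] (hrel : ∀ T, Complete 0 n T →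
      rel (classSet k n T) = arcClass k n '' {e | e ∈ T ∧ Q T e}) (m : ℕ) :
    {S : Set (LinearRepClass k n) | IsExceptionalSet S ∧ (rel S).ncard = m}.ncard =
      {T : Finset (ℕ × ℕ) | Complete 0 n T ∧ (T.filter (Q T)).card = m}.ncard := by
  have hcard : ∀ T, Complete 0 n T → (rel (classSet k n T)).ncard = (T.filter (Q T)).card := by
    intro T hT
    rw [hrel T hT, Set.InjOn.ncard_image (arcClass_injOn.mono fun e he => hT.isArc he.1),
      ← Set.ncard_coe_finset, Finset.coe_filter]
  rw [← Set.InjOn.ncard_image (f := classSet k n) (classSet_injOn.mono fun T hT => hT.1)]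
  congr 1
  ext S
  constructor
  · rintro ⟨hS, hm⟩
    obtain ⟨T, hT, rfl⟩ := isExceptionalSet_iff.1 hS
    exact ⟨T, ⟨hT, (hcard T hT).symm.trans hm⟩, rfl⟩
  · rintro ⟨T, ⟨hT, hm⟩, rfl⟩
    exact ⟨isExceptionalSet_iff.2 ⟨T, hT, rfl⟩, (hcard T hT).trans hm⟩

theorem numRelProjective_eq_count (n m : ℕ) :
    numRelProjective k n m = TernaryTree.count n m := by
  classical
  rw [← ncard_complete]
  exact ncard_isExceptionalSet (k := k) (Q := fun T e => ¬ NonProj (n + m) T e)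
    (fun T hT => relProjectives_classSet (k := k) hT) n

/-- Reflection permutes the complete sets of arcs and carries relatively injective arcs to
relatively projective ones. -/
theorem numRelInjective_eq_count (n m : ℕ) :
    numRelInjective k n m = TernaryTree.count n m := by
  classical
  rw [← ncard_complete]
  refine (ncard_isExceptionalSet (k := k) (Q := fun T e =>
    ¬ NonProj (n + m) (T.image (flipArc (n + m))) (flipArc (n + m) e))
    (fun T hT => relInjectives_classSet (k := k) hT) n).trans ?_
  have hle : ∀ {T}, Complete 0 (n + m) T → ∀ x ∈ T, x.1 ≤ n + m ∧ x.2 ≤ n + m :=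
    fun hT x hx => by have := hT.arc x hx; omega
  have hflip : ∀ {T}, Complete 0 (n + m) T → Complete 0 (n + m) (T.image (flipArc (n + m))) :=
    fun hT => by simpa using hT.flip le_rfl
  have hcard : ∀ {T}, Complete 0 (n + m) T → (T.filter fun e =>
      ¬ NonProj (n + m) (T.image (flipArc (n + m))) (flipArc (n + m) e)).card =
      ((T.image (flipArc (n + m))).filter fun e =>
        ¬ NonProj (n + m) (T.image (flipArc (n + m))) e).card := fun {T} hT => by
    rw [Finset.filter_image, Finset.card_image_of_injOn]
    intro x hx y hy h
    have hx' := hle hT x (Finset.mem_filter.1 (Finset.mem_coe.1 hx)).1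
    have hy' := hle hT y (Finset.mem_filter.1 (Finset.mem_coe.1 hy)).1
    rw [← flipArc_flipArc hx'.1 hx'.2, h, flipArc_flipArc hy'.1 hy'.2]
  refine Set.ncard_congr (fun T _ => T.image (flipArc (n + m))) ?_ ?_ ?_
  · rintro T ⟨hT, hc⟩
    exact ⟨hflip hT, (hcard hT).symm.trans hc⟩
  · rintro T T' ⟨hT, -⟩ ⟨hT', -⟩ h
    rw [← image_flipArc_image_flipArc (hle hT), h, image_flipArc_image_flipArc (hle hT')]
  · rintro T ⟨hT, hc⟩
    have h2 := image_flipArc_image_flipArc (hle hT)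
    refine ⟨T.image (flipArc (n + m)), ⟨hflip hT, (hcard (hflip hT)).trans ?_⟩, h2⟩
    rw [h2]
    exact hc

end LinearRep

theorem mainTheorem9 :
    (∀ N : ℕ → ℕ → ℕ, SatisfiesRecursion N ↔ SatisfiesFunctionalEquation N) ∧
    ∀ (k : Type u) [Field k],
      (∀ n : ℕ, {S : Set (LinearRepClass k n) | IsExceptionalSet S}.Finite) ∧
      (SatisfiesRecursion (numRelInjective k) ∧
        SatisfiesFunctionalEquation (numRelInjective k) ∧
        ∀ n : ℕ, numRelInjective k n 0 = catalan n ∧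
          (numRelInjective k n 0 : ℚ) = 1 / ((n : ℚ) + 1) * ((2 * n).choose n : ℚ)) ∧
      (SatisfiesRecursion (numRelProjective k) ∧
        SatisfiesFunctionalEquation (numRelProjective k) ∧
        ∀ n : ℕ, numRelProjective k n 0 = catalan n ∧
          (numRelProjective k n 0 : ℚ) = 1 / ((n : ℚ) + 1) * ((2 * n).choose n : ℚ)) := by
  have hrec := TernaryTree.satisfiesRecursion_count
  have hcat : ∀ n, TernaryTree.count n 0 = catalan n ∧
      (TernaryTree.count n 0 : ℚ) = 1 / ((n : ℚ) + 1) * ((2 * n).choose n : ℚ) := fun n => by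
    rw [eq_catalan hrec]
    exact ⟨rfl, catalan_eq_div n⟩
  refine ⟨satisfiesRecursion_iff, fun k _ => ⟨fun n => LinearRep.finite_isExceptionalSet, ?_⟩⟩
  have hI : numRelInjective k = TernaryTree.count :=
    funext fun n => funext fun m => LinearRep.numRelInjective_eq_count n m
  have hP : numRelProjective k = TernaryTree.count :=
    funext fun n => funext fun m => LinearRep.numRelProjective_eq_count n m
  rw [hI, hP]
  exact ⟨⟨hrec, (satisfiesRecursion_iff _).1 hrec, hcat⟩,
    hrec, (satisfiesRecursion_iff _).1 hrec, hcat⟩
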